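/- Let $(\Omega,\mathcal H,\mathbb E)$ be a sublinear expectation space: $\mathcal H$ is a linear space of real functions on $\Omega$ that contains the constants, contains $|X|$ for each $X\in\mathcal H$, and contains $\phi(X_1,\dots,X_n)$ for all $X_1,\dots,X_n\in\mathcal H$ and every bounded Borel function $\phi:\mathbb R^n\to\mathbb R$; and $\mathbb E:\mathcal H\to\mathbb R$ is monotone, sub-additive, positively homogeneous and satisfies $\mathbb E[c]=c$ for constants $c$. Let $C_{l,lip}(\mathbb R^n)$ be the set of $\varphi:\mathbb R^n\to\mathbb R$ for which there are $C\in\mathbb R$ and $m\in\mathbb N$ with $|\varphi(x)-\varphi(y)|\le C(1+|x|^m+|y|^m)|x-y|$ for all $x,y$. For $0\le v_1\le v_2$ we write $\delta\overset{d}{=}N(0,[v_1,v_2])$ if, for every $\varphi\in C_{l,lip}(\mathbb R)$, all $\varphi(x+\sqrt t\,\delta)$ ($t\ge 0$, $x\in\mathbb R$) lie in $\mathcal H$ and $u(t,x)=\mathbb E[\varphi(x+\sqrt t\,\delta)]$ is a (continuous) viscosity solution on $[0,\infty)\times\mathbb R$ of the Cauchy problem $$\partial_t u-G(\partial^2_{xx}u)=0\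 \text{ on } (0,\infty)\times\mathbb R,\qquad u(0,x)=\varphi(x),\qquad G(a)=\tfrac12\left(v_2a^+-v_1a^-\right).$$ $Y$ is independent of $X$ under $\mathbb E$ if, for every bounded Borel $\phi:\mathbb R^2\to\mathbb R$, the function $g(X)$ with $g(x)=\mathbb E[\phi(x,Y)]$ lies in $\mathcal H$ and $\mathbb E[\phi(X,Y)]=\mathbb E[g(X)]$. **Theorem.** Let $Z'=\mathrm{Re}(Z')+i\,\mathrm{Im}(Z')$ be a complex random variable such that $\psi(\mathrm{Re}(Z'),\mathrm{Im}(Z'))\in\mathcal H$ for every $\psi\in C_{l,lip}(\mathbb R^2)$. Let $0\le\underline\sigma\le\overline\sigma$, let $\mathrm{Re}(Z')\overset{d}{=}N(0,[\underline\sigma^2,\overline\sigma^2])$ and $\mathrm{Im}(Z')\overset{d}{=}N(0,[\underline\sigma^2,\overline\sigma^2])$, and let $\mathrm{Im}(Z')$ be independent of $\mathrm{Re}(Z')$ under $\mathbb E$. Then for every $h\in\mathbb C$ $$\mathrm{Re}(hZ')\overset{d}{=}N(0,[|h|^2\underline\sigma^2,|h|^2\overline\sigma^2]),\qquad \mathrm{Im}(hZ')\overset{d}{=}N(0,[|h|^2\underline\sigma^2,|h|^2\overline\sigma^2]).$$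 Moreover, the solution is unique: for each $\varphi\in C_{l,lip}(\mathbb R)$, every viscosity solution $v$ of the Cauchy problem above with $v_1=|h|^2\underline\sigma^2$, $v_2=|h|^2\overline\sigma^2$ that grows at most polynomially in $x$, uniformly for $t$ in bounded intervals, satisfies $v(t,x)=\mathbb E[\varphi(x+\sqrt t\,\mathrm{Re}(hZ'))]=\mathbb E[\varphi(x+\sqrt t\,\mathrm{Im}(hZ'))]$ for all $t\ge0$, $x\in\mathbb R$. -/

import Mathlib

open Set

/-- A sublinear expectation space over `Ω`. `H` is the space of random variables: a linear space of
real functions that contains the constants and is closed under absolute values and under bounded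
Borel functions of finitely many variables. `E` is a sublinear expectation on `H`; it is written as a
total function, but nothing is assumed about its values off `H`. -/
structure SublinearExpectationSpace (Ω : Type*) where
  H : Submodule ℝ (Ω → ℝ)
  const_mem : ∀ c : ℝ, (fun _ => c) ∈ H
  abs_mem : ∀ X ∈ H, (fun ω => |X ω|) ∈ H
  comp_mem : ∀ (n : ℕ) (φ : (Fin n → ℝ) → ℝ), Measurable φ → (∃ C : ℝ, ∀ x, |φ x| ≤ C) →
    ∀ X : Fin n → Ω → ℝ, (∀ i, X i ∈ H) → (fun ω => φ (fun i => X i ω)) ∈ H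
  E : (Ω → ℝ) → ℝ
  mono : ∀ X ∈ H, ∀ Y ∈ H, (∀ ω, Y ω ≤ X ω) → E Y ≤ E X
  map_const : ∀ c : ℝ, E (fun _ => c) = c
  subadd : ∀ X ∈ H, ∀ Y ∈ H, E (fun ω => X ω + Y ω) ≤ E X + E Y
  pos_hom : ∀ X ∈ H, ∀ c : ℝ, 0 < c → E (fun ω => c * X ω) = c * E X

/-- `Y` is independent of `X`: `E[φ(X, Y)] = E[E[φ(x, Y)]|_{x = X}]` for all bounded Borel `φ` on
the plane. The membership clause says that the outer expectation on the right is defined. -/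
def SublinearExpectationSpace.IsIndependentOf {Ω : Type*} (S : SublinearExpectationSpace Ω)
    (Y X : Ω → ℝ) : Prop :=
  ∀ φ : ℝ × ℝ → ℝ, Measurable φ → (∃ C : ℝ, ∀ p, |φ p| ≤ C) →
    (fun ω => S.E (fun ω' => φ (X ω, Y ω'))) ∈ S.H ∧
    S.E (fun ω => φ (X ω, Y ω)) = S.E (fun ω => S.E (fun ω' => φ (X ω, Y ω')))

/-- The class `C_{l,lip}(V)`: locally Lipschitz functions whose local Lipschitz constants grow at
most polynomially. -/
def IsClLip {V : Type*} [NormedAddCommGroup V] (φ : V → ℝ) : Prop :=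
  ∃ (C : ℝ) (m : ℕ), ∀ x y : V, |φ x - φ y| ≤ C * (1 + ‖x‖ ^ m + ‖y‖ ^ m) * ‖x - y‖

/-- `G(a) = (vu a⁺ - vl a⁻) / 2`. -/
noncomputable def gFun (vl vu a : ℝ) : ℝ :=
  (1 / 2) * (vu * max a 0 - vl * max (-a) 0)

/-- `ψ` is of class `C^{1,2}` on `(0, ∞) × ℝ`, as a function of `(t, x)`. -/
structure IsC12 (ψ : ℝ → ℝ → ℝ) : Prop where
  diff_t : ∀ t > 0, ∀ x, DifferentiableAt ℝ (fun s => ψ s x) t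
  diff_x : ∀ t > 0, ContDiff ℝ 2 (ψ t)
  cont : ContinuousOn (fun p : ℝ × ℝ => ψ p.1 p.2) (Ioi 0 ×ˢ univ)
  cont_t : ContinuousOn (fun p : ℝ × ℝ => deriv (fun s => ψ s p.2) p.1) (Ioi 0 ×ˢ univ)
  cont_x : ContinuousOn (fun p : ℝ × ℝ => deriv (ψ p.1) p.2) (Ioi 0 ×ˢ univ)
  cont_xx : ContinuousOn (fun p : ℝ × ℝ => iteratedDeriv 2 (ψ p.1) p.2) (Ioi 0 ×ˢ univ)

/-- `u` is a viscosity solution on `[0, ∞) × ℝ` of `∂ₜu - G(∂ₓₓu) = 0`, `u(0, ·) = φ`. -/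
structure IsViscositySolution (vl vu : ℝ) (φ : ℝ → ℝ) (u : ℝ → ℝ → ℝ) : Prop where
  cont : ContinuousOn (fun p : ℝ × ℝ => u p.1 p.2) (Ici 0 ×ˢ univ)
  init : ∀ x, u 0 x = φ x
  sub : ∀ ψ : ℝ → ℝ → ℝ, IsC12 ψ → ∀ t > 0, ∀ x,
    IsLocalMax (fun p : ℝ × ℝ => u p.1 p.2 - ψ p.1 p.2) (t, x) →
      deriv (fun s => ψ s x) t - gFun vl vu (iteratedDeriv 2 (ψ t) x) ≤ 0
  super : ∀ ψ : ℝ → ℝ → ℝ, IsC12 ψ → ∀ t > 0, ∀ x,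
    IsLocalMin (fun p : ℝ × ℝ => u p.1 p.2 - ψ p.1 p.2) (t, x) →
      0 ≤ deriv (fun s => ψ s x) t - gFun vl vu (iteratedDeriv 2 (ψ t) x)

/-- Polynomial growth in `x`, uniformly for `t` in bounded intervals. -/
def HasPolynomialGrowth (u : ℝ → ℝ → ℝ) : Prop :=
  ∀ T : ℝ, ∃ (C : ℝ) (m : ℕ), ∀ t ∈ Icc 0 T, ∀ x, |u t x| ≤ C * (1 + |x| ^ m)

/-- The function `u(t, x) = E[φ(x + √t δ)]`. -/
noncomputable def SublinearExpectationSpace.flow {Ω : Type*} (S : SublinearExpectationSpace Ω)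
    (δ : Ω → ℝ) (φ : ℝ → ℝ) (t x : ℝ) : ℝ :=
  S.E (fun ω => φ (x + Real.sqrt t * δ ω))

/-- `δ` has the G-normal distribution `N(0, [vl, vu])`: for every `φ` in `C_{l,lip}(ℝ)` the random
variables `φ(x + √t δ)` lie in `H`, and `u(t, x) = E[φ(x + √t δ)]` is a viscosity solution of the
G-heat equation with initial value `φ`. -/
def SublinearExpectationSpace.IsGNormal {Ω : Type*} (S : SublinearExpectationSpace Ω)
    (δ : Ω → ℝ) (vl vu : ℝ) : Prop :=
  ∀ φ : ℝ → ℝ, IsClLip φ →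
    (∀ t ≥ 0, ∀ x, (fun ω => φ (x + Real.sqrt t * δ ω)) ∈ S.H) ∧
    IsViscositySolution vl vu φ (S.flow δ φ)

/-! Let u be the flow E[φ(x + √t X)] of one G-normal variable X. Everything follows from uniqueness
for the G-heat equation. The function u(s + t, x) solves the equation with initial value u(s, ·), so
flows form a semigroup (`IsGNormal.flow_flow`); reflecting x shows that X and -X have the same flows
(`IsGNormal.E_affine`); and the real and imaginary parts of Z have the same flows
(`IsGNormal.flow_eq`). Independence, extended from bounded Borel functions to C_{l,lip} by
truncation (`IsIndependentOf.E_eq`), turns E[φ(x + √t (cX + dY))] into an iterated expectation: the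
inner one is the flow for time d²t, the outer one runs it for a further c²t. The result is u((c² +
d²)t, x), and stretching time by c² + d² multiplies both coefficients by that factor. Re(hZ) and
Im(hZ) are such combinations with c² + d² = |h|².

Uniqueness is the comparison principle `IsSubSol.le_of_isSubSol_neg`, proved without doubling
variables. Since G(a) = max(v₁a/2, v₂a/2), a supersolution w of the G-equation is a supersolution of
two linear heat equations. Comparison of w with smooth heat flows gives w(t + s) ≥ P_s w(t) for each
of the two heat semigroups (`HeatSuper`). This inequality is linear and translation invariant, so it
survives averaging w over small boxes. The average W is of class C^{1,2}, and differentiation at s =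
0 gives W_t ≥ G(W_xx) classically. A viscosity subsolution is compared with W by using W plus a
barrier as test function (`IsSubSol.le_of_classical`); then the boxes shrink. -/

open Filter Topology
open MeasureTheory ProbabilityTheory

/-! ### Calculus of C^{1,2} functions -/

/-- `u` has the continuous derivatives `ut`, `ux`, `uxx` on `(0, ∞) × ℝ`. -/
structure HasC12 (u ut ux uxx : ℝ → ℝ → ℝ) : Prop where
  dt : ∀ t > 0, ∀ x, HasDerivAt (fun s => u s x) (ut t x) t
  dx : ∀ t > 0, ∀ x, HasDerivAt (u t) (ux t x) x
  dxx : ∀ t > 0, ∀ x, HasDerivAt (ux t) (uxx t x) x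
  cont : ContinuousOn (fun p : ℝ × ℝ => u p.1 p.2) (Ioi 0 ×ˢ univ)
  cont_t : ContinuousOn (fun p : ℝ × ℝ => ut p.1 p.2) (Ioi 0 ×ˢ univ)
  cont_x : ContinuousOn (fun p : ℝ × ℝ => ux p.1 p.2) (Ioi 0 ×ˢ univ)
  cont_xx : ContinuousOn (fun p : ℝ × ℝ => uxx p.1 p.2) (Ioi 0 ×ˢ univ)

namespace HasC12

variable {u ut ux uxx v vt vx vxx : ℝ → ℝ → ℝ}

theorem deriv_t (h : HasC12 u ut ux uxx) {t : ℝ} (ht : 0 < t) (x : ℝ) :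
    deriv (fun s => u s x) t = ut t x := (h.dt t ht x).deriv

theorem deriv_x (h : HasC12 u ut ux uxx) {t : ℝ} (ht : 0 < t) : deriv (u t) = ux t :=
  funext fun x => (h.dx t ht x).deriv

theorem deriv_xx (h : HasC12 u ut ux uxx) {t : ℝ} (ht : 0 < t) :
    iteratedDeriv 2 (u t) = uxx t := by
  rw [iteratedDeriv_succ, iteratedDeriv_one, h.deriv_x ht]
  exact funext fun x => (h.dxx t ht x).deriv

theorem isC12 (h : HasC12 u ut ux uxx) : IsC12 u where
  diff_t t ht x := (h.dt t ht x).differentiableAt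
  diff_x t ht := by
    have e : (2 : WithTop ℕ∞) = 1 + 1 := by norm_num
    rw [e, contDiff_succ_iff_deriv]
    refine ⟨fun x => (h.dx t ht x).differentiableAt, by simp, ?_⟩
    rw [h.deriv_x ht, contDiff_one_iff_deriv]
    refine ⟨fun x => (h.dxx t ht x).differentiableAt, ?_⟩
    have : deriv (ux t) = uxx t := funext fun x => (h.dxx t ht x).deriv
    rw [this]
    exact h.cont_xx.comp_continuous (f := fun x : ℝ => (t, x)) (by fun_prop) (by simp [ht])
  cont := h.cont
  cont_t := h.cont_t.congr fun p hp => h.deriv_t hp.1 p.2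
  cont_x := h.cont_x.congr fun p hp => congrFun (h.deriv_x hp.1) p.2
  cont_xx := h.cont_xx.congr fun p hp => congrFun (h.deriv_xx hp.1) p.2

theorem add (h : HasC12 u ut ux uxx) (k : HasC12 v vt vx vxx) :
    HasC12 (fun t x => u t x + v t x) (fun t x => ut t x + vt t x)
      (fun t x => ux t x + vx t x) (fun t x => uxx t x + vxx t x) where
  dt t ht x := (h.dt t ht x).add (k.dt t ht x)
  dx t ht x := (h.dx t ht x).add (k.dx t ht x)
  dxx t ht x := (h.dxx t ht x).add (k.dxx t ht x)
  cont := h.cont.add k.cont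
  cont_t := h.cont_t.add k.cont_t
  cont_x := h.cont_x.add k.cont_x
  cont_xx := h.cont_xx.add k.cont_xx

theorem neg (h : HasC12 u ut ux uxx) :
    HasC12 (fun t x => -u t x) (fun t x => -ut t x) (fun t x => -ux t x)
      (fun t x => -uxx t x) where
  dt t ht x := (h.dt t ht x).neg
  dx t ht x := (h.dx t ht x).neg
  dxx t ht x := (h.dxx t ht x).neg
  cont := h.cont.neg
  cont_t := h.cont_t.neg
  cont_x := h.cont_x.neg
  cont_xx := h.cont_xx.neg

/-- Products of a function of `t` and a function of `x`. -/
theorem prod {f f' g g' g'' : ℝ → ℝ} (hf : ∀ t, HasDerivAt f (f' t) t) (hf' : Continuous f')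
    (hg : ∀ x, HasDerivAt g (g' x) x) (hg' : ∀ x, HasDerivAt g' (g'' x) x)
    (hg'' : Continuous g'') :
    HasC12 (fun t x => f t * g x) (fun t x => f' t * g x) (fun t x => f t * g' x)
      (fun t x => f t * g'' x) := by
  have cf : Continuous f := continuous_iff_continuousAt.2 fun t => (hf t).continuousAt
  have cg : Continuous g := continuous_iff_continuousAt.2 fun t => (hg t).continuousAt
  have cg' : Continuous g' := continuous_iff_continuousAt.2 fun t => (hg' t).continuousAt
  refine ⟨fun t _ x => (hf t).mul_const _, fun t _ x => (hg x).const_mul _,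
    fun t _ x => (hg' x).const_mul _, ?_, ?_, ?_, ?_⟩
  all_goals exact Continuous.continuousOn (by fun_prop)

end HasC12

/-- A function of class `C^{1,2}` has its derivatives as continuous derivatives. -/
theorem IsC12.hasC12 {ψ : ℝ → ℝ → ℝ} (h : IsC12 ψ) :
    HasC12 ψ (fun t x => deriv (fun s => ψ s x) t) (fun t x => deriv (ψ t) x)
      (fun t x => iteratedDeriv 2 (ψ t) x) where
  dt t ht x := (h.diff_t t ht x).hasDerivAt
  dx t ht x := ((h.diff_x t ht).differentiable (by norm_num) x).hasDerivAt
  dxx t ht x := by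
    have : Differentiable ℝ (deriv (ψ t)) := by
      have := (h.diff_x t ht).differentiable_iteratedDeriv 1 (by norm_num)
      rwa [iteratedDeriv_one] at this
    rw [iteratedDeriv_succ, iteratedDeriv_one]
    exact (this x).hasDerivAt
  cont := h.cont
  cont_t := h.cont_t
  cont_x := h.cont_x
  cont_xx := h.cont_xx

theorem IsC12.neg {ψ : ℝ → ℝ → ℝ} (h : IsC12 ψ) : IsC12 (fun t x => -ψ t x) :=
  h.hasC12.neg.isC12

/-! ### Viscosity subsolutions and changes of variables -/

/-- The viscosity inequality `∂ₜu - F(∂ₓₓu) ≤ 0` on `(0, ∞) × ℝ`. -/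
def IsSubSol (F : ℝ → ℝ) (u : ℝ → ℝ → ℝ) : Prop :=
  ∀ ψ : ℝ → ℝ → ℝ, IsC12 ψ → ∀ t > 0, ∀ x,
    IsLocalMax (fun p : ℝ × ℝ => u p.1 p.2 - ψ p.1 p.2) (t, x) →
      deriv (fun s => ψ s x) t - F (iteratedDeriv 2 (ψ t) x) ≤ 0

theorem IsSubSol.mono {F F' : ℝ → ℝ} {u : ℝ → ℝ → ℝ} (h : IsSubSol F u) (hF : ∀ X, F X ≤ F' X) :
    IsSubSol F' u := fun ψ hψ t ht x hx => by
  have := h ψ hψ t ht x hx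
  linarith [hF (iteratedDeriv 2 (ψ t) x)]

/-- Negation swaps maxima and minima, so supersolutions for F are the negatives of subsolutions for
X ↦ -F(-X). Only subsolutions need to be studied. -/
theorem isSubSol_neg_iff {F : ℝ → ℝ} {u : ℝ → ℝ → ℝ} :
    IsSubSol (fun X => -F (-X)) (fun t x => -u t x) ↔
      ∀ ψ : ℝ → ℝ → ℝ, IsC12 ψ → ∀ t > 0, ∀ x,
        IsLocalMin (fun p : ℝ × ℝ => u p.1 p.2 - ψ p.1 p.2) (t, x) →
          0 ≤ deriv (fun s => ψ s x) t - F (iteratedDeriv 2 (ψ t) x) := by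
  constructor
  · intro h ψ hψ t ht x hx
    have := h _ hψ.neg t ht x (by
      refine hx.neg.congr (.of_forall fun p => ?_)
      simp; ring)
    rw [hψ.hasC12.neg.deriv_xx ht, hψ.hasC12.neg.deriv_t ht] at this
    simp only [neg_neg] at this
    linarith
  · intro h ψ hψ t ht x hx
    have := h _ hψ.neg t ht x (by
      refine hx.neg.congr (.of_forall fun p => ?_)
      simp; ring)
    rw [hψ.hasC12.neg.deriv_xx ht, hψ.hasC12.neg.deriv_t ht] at this
    linarith

/-- A smooth map of the line into `(0, ∞)` that is the identity near `s₀ > 0`. -/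
theorem exists_pos_smooth_eq_id {s₀ : ℝ} (hs : 0 < s₀) :
    ∃ θ : ℝ → ℝ, ContDiff ℝ 1 θ ∧ (∀ s, 0 < θ s) ∧ ∀ s, s₀ / 2 ≤ s → θ s = s := by
  refine ⟨fun s => s₀ / 4 + (s - s₀ / 4) * Real.smoothTransition ((s - s₀ / 4) / (s₀ / 4)),
    ?_, ?_, ?_⟩
  · have := (Real.smoothTransition.contDiff (n := 1)).comp
      (show ContDiff ℝ 1 fun s : ℝ => (s - s₀ / 4) / (s₀ / 4) by fun_prop)
    have h2 : ContDiff ℝ 1 fun s : ℝ => Real.smoothTransition ((s - s₀ / 4) / (s₀ / 4)) := this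
    fun_prop
  · intro s
    rcases le_total s (s₀ / 4) with h | h
    · have : (s - s₀ / 4) / (s₀ / 4) ≤ 0 := div_nonpos_of_nonpos_of_nonneg (by linarith) (by linarith)
      simp only [Real.smoothTransition.zero_of_nonpos this]; linarith
    · have := mul_nonneg (sub_nonneg.2 h) (Real.smoothTransition.nonneg ((s - s₀ / 4) / (s₀ / 4)))
      show 0 < s₀ / 4 + _
      linarith
  · intro s h
    have : 1 ≤ (s - s₀ / 4) / (s₀ / 4) := by rw [le_div_iff₀ (by linarith)]; linarith
    simp only [Real.smoothTransition.one_of_one_le this]; ring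

/-- Time shifts, time changes and reflections of a subsolution. -/
theorem IsSubSol.comp_affine {F : ℝ → ℝ} {u : ℝ → ℝ → ℝ} (hu : IsSubSol F u) {k t₀ r : ℝ}
    (hk : 0 < k) (ht₀ : 0 ≤ t₀) (hr : r * r = 1) :
    IsSubSol (fun X => k * F X) (fun t x => u (t₀ + k * t) (r * x)) := by
  intro ψ hψ s hs x hx
  -- The pulled-back test function evaluates ψ at (t - t₀) / k, possibly a nonpositive time, where
  -- nothing is known of ψ. Composition with θ keeps the time positive and changes nothing near s.
  obtain ⟨θ, hθ, hpos, hid⟩ := exists_pos_smooth_eq_id hs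
  have H := hψ.hasC12
  have hθd : ∀ t, HasDerivAt θ (deriv θ t) t := fun t =>
    (hθ.differentiable (by norm_num) t).hasDerivAt
  have hθc : Continuous (deriv θ) := hθ.continuous_deriv (by norm_num)
  have hθc0 : Continuous θ := hθ.continuous
  have hl : ∀ t, HasDerivAt (fun t => (t - t₀) / k) (1 / k) t := fun t =>
    ((hasDerivAt_id t).sub_const t₀).div_const k
  have hθl : ∀ t, HasDerivAt (fun t => θ ((t - t₀) / k)) (deriv θ ((t - t₀) / k) * (1 / k)) t :=
    fun t => (hθd _).comp t (hl t)
  have hr' : ∀ y, HasDerivAt (fun y => r * y) r y := fun y => by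
    simpa using (hasDerivAt_id y).const_mul r
  have key : ∀ f : ℝ → ℝ → ℝ, ContinuousOn (fun p : ℝ × ℝ => f p.1 p.2) (Ioi 0 ×ˢ univ) →
      Continuous fun p : ℝ × ℝ => f (θ ((p.1 - t₀) / k)) (r * p.2) := fun f hf =>
    hf.comp_continuous (f := fun p : ℝ × ℝ => (θ ((p.1 - t₀) / k), r * p.2)) (by fun_prop)
      (fun p => ⟨hpos _, mem_univ _⟩)
  have H' : HasC12 (fun t y => ψ (θ ((t - t₀) / k)) (r * y))
      (fun t y => deriv (fun s => ψ s (r * y)) (θ ((t - t₀) / k)) *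
        (deriv θ ((t - t₀) / k) * (1 / k)))
      (fun t y => deriv (ψ (θ ((t - t₀) / k))) (r * y) * r)
      (fun t y => iteratedDeriv 2 (ψ (θ ((t - t₀) / k))) (r * y) * r * r) := by
    refine ⟨fun t _ y => ?_, fun t _ y => ?_, fun t _ y => ?_, ?_, ?_, ?_, ?_⟩
    · exact (H.dt (θ ((t - t₀) / k)) (hpos _) (r * y)).comp t (hθl t)
    · exact (H.dx _ (hpos _) _).comp y (hr' y)
    · exact ((H.dxx _ (hpos _) _).comp y (hr' y)).mul_const r
    · exact (key _ H.cont).continuousOn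
    · exact ((key (fun t x => deriv (fun s => ψ s x) t) H.cont_t).mul (by fun_prop)).continuousOn
    · exact ((key (fun t x => deriv (ψ t) x) H.cont_x).mul (by fun_prop)).continuousOn
    · exact (((key (fun t x => iteratedDeriv 2 (ψ t) x) H.cont_xx).mul continuous_const).mul continuous_const).continuousOn
  have ht : 0 < t₀ + k * s := by positivity
  have e1 : (t₀ + k * s - t₀) / k = s := by field_simp; ring
  have e2 : r * (r * x) = x := by rw [← mul_assoc, hr, one_mul]
  have e3 : θ s = s := hid s (by linarith)
  have e4 : deriv θ s = 1 := by
    have : θ =ᶠ[𝓝 s] id := by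
      filter_upwards [eventually_gt_nhds (show s / 2 < s by linarith)] with y hy using hid y hy.le
    rw [this.deriv_eq, deriv_id]
  have hmax : IsLocalMax (fun p : ℝ × ℝ => u p.1 p.2 - ψ (θ ((p.1 - t₀) / k)) (r * p.2))
      (t₀ + k * s, r * x) := by
    have hc : Tendsto (fun p : ℝ × ℝ => ((p.1 - t₀) / k, r * p.2)) (𝓝 (t₀ + k * s, r * x))
        (𝓝 (s, x)) := by
      have : Continuous (fun p : ℝ × ℝ => ((p.1 - t₀) / k, r * p.2)) := by fun_prop
      have h := this.tendsto (t₀ + k * s, r * x)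
      simpa only [e1, e2] using h
    have h1 := hc.eventually hx
    have h2 : ∀ᶠ p : ℝ × ℝ in 𝓝 (t₀ + k * s, r * x), s / 2 < (p.1 - t₀) / k := by
      have := hc.eventually (continuous_fst.tendsto (s, x) |>.eventually
        (eventually_gt_nhds (show s / 2 < s by linarith)))
      exact this
    filter_upwards [h1, h2] with p hp hp2
    simp only [e1, e2, e3, hid _ hp2.le]
    have e5 : t₀ + k * ((p.1 - t₀) / k) = p.1 := by field_simp; ring
    have e6 : r * (r * p.2) = p.2 := by rw [← mul_assoc, hr, one_mul]
    simpa only [e5, e6] using hp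
  have := hu _ H'.isC12 _ ht _ hmax
  rw [H'.deriv_t ht, H'.deriv_xx ht] at this
  simp only [e1, e2, e3, e4] at this
  rw [mul_assoc, hr, mul_one] at this
  have h3 := mul_le_mul_of_nonneg_left this hk.le
  have h4 : k * (deriv (fun s => ψ s x) s * (1 * (1 / k))) = deriv (fun s => ψ s x) s := by
    field_simp
  simp only [mul_sub, h4, mul_zero] at h3
  exact h3

/-! ### Comparison with a classical supersolution -/

/-- Exponential growth in `x`, uniformly for `t` in bounded intervals. -/
def ExpGrowth (u : ℝ → ℝ → ℝ) : Prop :=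
  ∀ T : ℝ, ∃ C : ℝ, ∀ t ∈ Icc 0 T, ∀ x, |u t x| ≤ C * Real.exp |x|

theorem exp_two_mul_abs_le (x : ℝ) : Real.exp |x| ^ 2 ≤ 2 * Real.cosh (2 * x) := by
  rw [← Real.cosh_abs, Real.cosh_eq, ← Real.exp_nat_mul, abs_mul, abs_two]
  push_cast
  linarith [Real.exp_pos (-(2 * |x|))]

/-- The square of exp |x| is at most 2 cosh (2x). This confines the maxima of penalised differences
to a bounded set. -/
theorem exists_exp_le_cosh (C : ℝ) {ε : ℝ} (hε : 0 < ε) :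
    ∃ R > 0, ∀ x, R ≤ |x| → C * Real.exp |x| ≤ ε * Real.cosh (2 * x) := by
  refine ⟨max 1 (2 * C / ε), by positivity, fun x hx => ?_⟩
  have h1 : 2 * C / ε ≤ Real.exp |x| :=
    ((le_max_right _ _).trans hx).trans (by linarith [Real.add_one_le_exp |x|])
  rw [div_le_iff₀ hε] at h1
  have h2 := exp_two_mul_abs_le x
  nlinarith [Real.exp_pos |x|, mul_le_mul_of_nonneg_right h1 (Real.exp_pos |x|).le]

/-- Comparison of a viscosity subsolution with a classical supersolution. -/
theorem IsSubSol.le_of_classical {F : ℝ → ℝ} {Λ : ℝ} (hΛ : 0 ≤ Λ)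
    (hF : ∀ X p, 0 ≤ p → F (X + p) ≤ F X + Λ * p) {u : ℝ → ℝ → ℝ} (hu : IsSubSol F u)
    (huc : ContinuousOn (fun p : ℝ × ℝ => u p.1 p.2) (Ici 0 ×ˢ univ)) (hug : ExpGrowth u)
    {W Wt Wx Wxx : ℝ → ℝ → ℝ} (hW : HasC12 W Wt Wx Wxx)
    (hWc : ContinuousOn (fun p : ℝ × ℝ => W p.1 p.2) (Ici 0 ×ˢ univ)) (hWg : ExpGrowth W)
    (hsup : ∀ t > 0, ∀ x, F (Wxx t x) ≤ Wt t x) {ε : ℝ} (hε : 0 < ε)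
    (h0 : ∀ x, u 0 x ≤ W 0 x + ε * Real.cosh (2 * x)) {t : ℝ} (ht : 0 ≤ t) (x : ℝ) :
    u t x ≤ W t x + ε * (Real.exp ((4 * Λ + 1) * t) * Real.cosh (2 * x)) := by
  by_contra! hlt
  -- The second derivative of cosh (2x) is four times itself, so the barrier P below satisfies ∂ₜP =
  -- Λ ∂ₓₓP + P. The surplus P makes the final inequality strict.
  set K := 4 * Λ + 1 with hK
  set P : ℝ → ℝ → ℝ := fun t x => ε * (Real.exp (K * t) * Real.cosh (2 * x)) with hP
  set T := t + 1 with hT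
  have hTpos : 0 < T := by linarith
  obtain ⟨C₁, hC₁⟩ := hug T
  obtain ⟨C₂, hC₂⟩ := hWg T
  obtain ⟨R, hR, hRx⟩ := exists_exp_le_cosh (C₁ + C₂) hε
  have hPge : ∀ s ∈ Icc 0 T, ∀ y, ε * Real.cosh (2 * y) ≤ P s y := by
    intro s hs y
    have : 1 ≤ Real.exp (K * s) := Real.one_le_exp (mul_nonneg (by linarith) hs.1)
    refine mul_le_mul_of_nonneg_left ?_ hε.le
    nlinarith [Real.cosh_pos (2 * y)]
  have hout : ∀ s ∈ Icc 0 T, ∀ y, R ≤ |y| → u s y - W s y - P s y ≤ 0 := by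
    intro s hs y hy
    have := abs_le.1 (hC₁ s hs y)
    have := abs_le.1 (hC₂ s hs y)
    have := hRx y hy
    have := hPge s hs y
    linarith
  have hcomp : IsCompact (Icc 0 T ×ˢ Icc (-R) R) := isCompact_Icc.prod isCompact_Icc
  have hsub : Icc 0 T ×ˢ Icc (-R) R ⊆ Ici (0 : ℝ) ×ˢ (univ : Set ℝ) :=
    prod_mono Icc_subset_Ici_self (subset_univ _)
  have hDc : ContinuousOn (fun p : ℝ × ℝ => u p.1 p.2 - W p.1 p.2 - P p.1 p.2)
      (Icc 0 T ×ˢ Icc (-R) R) :=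
    ((huc.mono hsub).sub (hWc.mono hsub)).sub (Continuous.continuousOn (by fun_prop))
  obtain ⟨M, hM⟩ := (hcomp.bddAbove_image hDc)
  have hxR : |x| < R := by
    by_contra! h
    have := hout t ⟨ht, by linarith⟩ x h
    simp only [hP] at this
    linarith
  have hmem : (t, x) ∈ Icc 0 T ×ˢ Icc (-R) R :=
    ⟨⟨ht, by linarith⟩, abs_le.1 hxR.le⟩
  set d := u t x - W t x - P t x with hd
  have hdpos : 0 < d := by simp only [hd, hP]; linarith
  have hdM : d ≤ M := hM ⟨_, hmem, rfl⟩
  have hMpos : 0 < M := by linarith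
  -- The penalty M (s / T)^n excludes a positive maximum at s = T, where it equals the bound M, yet
  -- it is below d at time t < T for large n. Unlike 1 / (T - s) it is smooth for all times, as a
  -- test function must be, and being increasing it has a time derivative of the harmless sign.
  obtain ⟨n, hn⟩ := exists_pow_lt_of_lt_one (show 0 < d / M by positivity)
    (show t / T < 1 by rw [div_lt_one hTpos]; linarith)
  rw [lt_div_iff₀ hMpos] at hn
  obtain ⟨⟨s, y⟩, hsy, hmax⟩ := hcomp.exists_isMaxOn ⟨_, hmem⟩
    (hDc.sub (Continuous.continuousOn (show Continuous fun p : ℝ × ℝ => M * (p.1 / T) ^ n by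
      fun_prop)))
  have hval : 0 < u s y - W s y - P s y - M * (s / T) ^ n := by
    have := hmax hmem
    simp only [Pi.sub_apply, mem_ofPred_eq] at this
    have h2 : d = u t x - W t x - P t x := rfl
    linarith
  have hpow : 0 ≤ M * (s / T) ^ n := by
    have := hsy.1.1
    positivity
  have hs0 : 0 < s := by
    rcases hsy.1.1.eq_or_lt with h | h
    · exfalso
      have h1 := h0 y
      have h2 := hPge 0 ⟨le_rfl, hTpos.le⟩ y
      simp only at h
      subst h
      linarith
    · exact h
  have hsT : s < T := by
    rcases hsy.1.2.eq_or_lt with h | h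
    · exfalso
      simp only at h
      have := hM ⟨_, hsy, rfl⟩
      simp only at this
      rw [h, div_self hTpos.ne', one_pow] at hval
      rw [h] at this
      linarith
    · exact h
  have hyR : |y| < R := by
    by_contra! h
    have := hout s hsy.1 y h
    linarith
  have hP' : HasC12 P (fun t x => K * P t x) (fun t x => ε * (Real.exp (K * t) *
      (2 * Real.sinh (2 * x)))) (fun t x => 4 * P t x) := by
    have := HasC12.prod (f := fun t => ε * Real.exp (K * t))
      (f' := fun t => ε * (Real.exp (K * t) * K))
      (g := fun x => Real.cosh (2 * x)) (g' := fun x => 2 * Real.sinh (2 * x))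
      (g'' := fun x => 4 * Real.cosh (2 * x))
      (fun t => by
        have := (((hasDerivAt_id t).const_mul K).exp).const_mul ε
        simpa using this) (by fun_prop)
      (fun x => by
        have := ((hasDerivAt_id x).const_mul 2).cosh
        simpa [mul_comm] using this)
      (fun x => by
        have := (((hasDerivAt_id x).const_mul 2).sinh).const_mul 2
        simp only [id, mul_one] at this
        exact this.congr_deriv (by ring)) (by fun_prop)
    convert this using 3 <;> simp only [hP, mul_assoc, mul_left_comm]
  have hQ : HasC12 (fun t _ : ℝ => M * (t / T) ^ n) (fun t _ => M * (n * (t / T) ^ (n - 1) * (1 / T)))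
      (fun _ _ => 0) (fun _ _ => 0) := by
    have := HasC12.prod (f := fun t => M * (t / T) ^ n)
      (f' := fun t => M * (n * (t / T) ^ (n - 1) * (1 / T)))
      (g := fun _ => 1) (g' := fun _ => 0) (g'' := fun _ => 0)
      (fun t => ((((hasDerivAt_id t).div_const T).pow n)).const_mul M) (by fun_prop)
      (fun x => hasDerivAt_const _ _) (fun x => hasDerivAt_const _ _) (by fun_prop)
    simpa using this
  have hψ := (hW.add hP').add hQ
  have hloc : IsLocalMax (fun p : ℝ × ℝ => u p.1 p.2 - (W p.1 p.2 + P p.1 p.2 + M * (p.1 / T) ^ n))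
      (s, y) := by
    have hnhds : Icc 0 T ×ˢ Icc (-R) R ∈ 𝓝 (s, y) :=
      prod_mem_nhds (Icc_mem_nhds hs0 hsT) (Icc_mem_nhds (abs_lt.1 hyR).1 (abs_lt.1 hyR).2)
    filter_upwards [hnhds] with p hp
    have := hmax hp
    simp only [Pi.sub_apply, mem_ofPred_eq] at this
    linarith
  have := hu _ hψ.isC12 s hs0 y hloc
  rw [hψ.deriv_t hs0, hψ.deriv_xx hs0] at this
  have hPpos : 0 < P s y := by
    have := Real.cosh_pos (2 * y)
    positivity
  -- At the maximum, Wt + K P ≤ F (Wxx + 4 P) ≤ Wt + 4 Λ P, which contradicts P > 0.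
  have h1 := hF (Wxx s y) (4 * P s y) (by linarith)
  have h2 := hsup s hs0 y
  have h3 : 0 ≤ M * (n * (s / T) ^ (n - 1) * (1 / T)) := by positivity
  have h4 : K * P s y = Λ * (4 * P s y) + P s y := by rw [hK]; ring
  simp only [add_zero] at this
  linarith

/-! ### Gaussian averages and the heat semigroup -/

/-- The average of `f (x + c z)` over a standard normal variable `z`. -/
noncomputable def gaussAvg (c : ℝ) (f : ℝ → ℝ) (x : ℝ) : ℝ :=
  ∫ z, f (x + c * z) ∂gaussianReal 0 1

theorem integrable_exp_mul_abs (k : ℝ) :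
    Integrable (fun z => Real.exp (k * |z|)) (gaussianReal 0 1) := by
  refine ((integrable_exp_mul_gaussianReal k).add (integrable_exp_mul_gaussianReal (-k))).mono'
    (by fun_prop) (.of_forall fun z => ?_)
  rw [Real.norm_eq_abs, abs_of_pos (Real.exp_pos _)]
  show _ ≤ Real.exp (k * z) + Real.exp (-k * z)
  rcases abs_cases z with ⟨h, _⟩ | ⟨h, _⟩ <;> rw [h]
  · linarith [Real.exp_pos (-k * z)]
  · rw [mul_neg, ← neg_mul]; linarith [Real.exp_pos (k * z)]

theorem integrable_gauss_of_le {f : ℝ → ℝ} (hf : Continuous f) {C k : ℝ}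
    (h : ∀ z, |f z| ≤ C * Real.exp (k * |z|)) : Integrable f (gaussianReal 0 1) :=
  ((integrable_exp_mul_abs k).const_mul C).mono' hf.aestronglyMeasurable (.of_forall h)

theorem continuousAt_integral_gauss {X : Type*} [TopologicalSpace X] [FirstCountableTopology X]
    {F : X → ℝ → ℝ} (hF : Continuous (Function.uncurry F)) {x₀ : X} {C k : ℝ}
    (h : ∀ᶠ x in 𝓝 x₀, ∀ z, |F x z| ≤ C * Real.exp (k * |z|)) :
    ContinuousAt (fun x => ∫ z, F x z ∂gaussianReal 0 1) x₀ := by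
  refine continuousAt_of_dominated (bound := fun z => C * Real.exp (k * |z|))
    (.of_forall fun x => ?_) (h.mono fun x hx => .of_forall hx)
    ((integrable_exp_mul_abs k).const_mul C) (.of_forall fun z => ?_)
  · exact (hF.comp (by fun_prop : Continuous fun z => (x, z))).aestronglyMeasurable
  · exact (hF.comp (by fun_prop : Continuous fun x => (x, z))).continuousAt

theorem hasDerivAt_integral_gauss {F F' : ℝ → ℝ → ℝ} (hF : ∀ τ, Continuous (F τ))
    (hF' : ∀ τ, Continuous (F' τ)) (hd : ∀ τ z, HasDerivAt (fun τ => F τ z) (F' τ z) τ) {τ₀ C k : ℝ}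
    (h0 : ∀ z, |F τ₀ z| ≤ C * Real.exp (k * |z|))
    (h : ∀ τ ∈ Metric.ball τ₀ 1, ∀ z, |F' τ z| ≤ C * Real.exp (k * |z|)) :
    HasDerivAt (fun τ => ∫ z, F τ z ∂gaussianReal 0 1) (∫ z, F' τ₀ z ∂gaussianReal 0 1) τ₀ :=
  (hasDerivAt_integral_of_dominated_loc_of_deriv_le (Metric.ball_mem_nhds τ₀ one_pos)
    (.of_forall fun τ => (hF τ).aestronglyMeasurable) (integrable_gauss_of_le (hF τ₀) h0)
    (hF' τ₀).aestronglyMeasurable (.of_forall fun z τ hτ => h τ hτ z)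
    ((integrable_exp_mul_abs k).const_mul C) (.of_forall fun z τ _ => hd τ z)).2

/-- Supplies the dominating functions for Gaussian integrals: the bound is uniform over bounded x
and c, and integrable in z. -/
theorem exp_abs_add_mul_le {C : ℝ} {f : ℝ → ℝ} (hf : ∀ y, |f y| ≤ C * Real.exp |y|) {x c X K : ℝ}
    (hx : |x| ≤ X) (hc : |c| ≤ K) (z : ℝ) :
    |f (x + c * z)| ≤ C * Real.exp X * Real.exp (K * |z|) := by
  have hC : 0 ≤ C := by
    have := (abs_nonneg _).trans (hf 0)
    simpa using this
  refine (hf _).trans ?_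
  rw [mul_assoc, ← Real.exp_add]
  refine mul_le_mul_of_nonneg_left (Real.exp_le_exp.2 ?_) hC
  refine (abs_add_le _ _).trans (add_le_add hx ?_)
  rw [abs_mul]
  exact mul_le_mul_of_nonneg_right hc (abs_nonneg z)

theorem continuous_gaussAvg {f : ℝ → ℝ} (hf : Continuous f) {C : ℝ}
    (hb : ∀ y, |f y| ≤ C * Real.exp |y|) :
    Continuous fun p : ℝ × ℝ => gaussAvg p.1 f p.2 := by
  refine continuous_iff_continuousAt.2 fun p₀ => ?_
  refine continuousAt_integral_gauss (F := fun (p : ℝ × ℝ) z => f (p.2 + p.1 * z))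
    (C := C * Real.exp (|p₀.2| + 1)) (k := |p₀.1| + 1) (by fun_prop) ?_
  have h1 : ∀ᶠ p : ℝ × ℝ in 𝓝 p₀, |p.2| < |p₀.2| + 1 :=
    (show Continuous fun p : ℝ × ℝ => |p.2| by fun_prop).continuousAt.eventually
      (eventually_lt_nhds (by linarith))
  have h2 : ∀ᶠ p : ℝ × ℝ in 𝓝 p₀, |p.1| < |p₀.1| + 1 :=
    (show Continuous fun p : ℝ × ℝ => |p.1| by fun_prop).continuousAt.eventually
      (eventually_lt_nhds (by linarith))
  filter_upwards [h1, h2] with p hp1 hp2 z using exp_abs_add_mul_le hb hp1.le hp2.le z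

theorem abs_gaussAvg_le {f : ℝ → ℝ} {C : ℝ}
    (hb : ∀ y, |f y| ≤ C * Real.exp |y|) {c K : ℝ} (hc : |c| ≤ K) (x : ℝ) :
    |gaussAvg c f x| ≤ C * (∫ z, Real.exp (K * |z|) ∂gaussianReal 0 1) * Real.exp |x| := by
  have := norm_integral_le_of_norm_le ((integrable_exp_mul_abs K).const_mul (C * Real.exp |x|))
    (f := fun z => f (x + c * z)) (.of_forall fun z => exp_abs_add_mul_le hb le_rfl hc z)
  rw [integral_const_mul] at this
  refine this.trans_eq ?_
  ring

theorem abs_mul_exp_mul_le (k z : ℝ) : Real.exp (k * |z|) * |z| ≤ Real.exp ((k + 1) * |z|) := by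
  rw [add_mul, one_mul, Real.exp_add]
  exact mul_le_mul_of_nonneg_left (by linarith [Real.add_one_le_exp |z|]) (Real.exp_pos _).le

theorem integrable_iff_integrable_gaussianPDFReal_mul {f : ℝ → ℝ} :
    Integrable f (gaussianReal 0 1) ↔ Integrable fun z => gaussianPDFReal 0 1 z * f z := by
  rw [gaussianReal_of_var_ne_zero _ one_ne_zero]
  rw [integrable_withDensity_iff_integrable_smul' (measurable_gaussianPDF _ _)
    (.of_forall fun _ => gaussianPDF_lt_top)]
  simp only [toReal_gaussianPDF, smul_eq_mul]

theorem hasDerivAt_gaussianPDFReal (z : ℝ) :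
    HasDerivAt (gaussianPDFReal 0 1) (-(z * gaussianPDFReal 0 1 z)) z := by
  rw [gaussianPDFReal_def]
  have h : HasDerivAt (fun x : ℝ => -(x - 0) ^ 2 / (2 * ((1 : NNReal) : ℝ))) (-z) z := by
    have := ((((hasDerivAt_id z).sub_const 0).pow 2).neg).div_const (2 * ((1 : NNReal) : ℝ))
    refine this.congr_deriv ?_
    simp
    ring
  refine (h.exp.const_mul _).congr_deriv ?_
  ring

/-- Gaussian integration by parts. -/
theorem integral_gauss_mul_eq {g g' : ℝ → ℝ} (hg : ∀ x, HasDerivAt g (g' x) x)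
    (hg' : Continuous g') {C : ℝ} (hb : ∀ y, |g y| ≤ C * Real.exp |y|)
    (hb' : ∀ y, |g' y| ≤ C * Real.exp |y|) (x c : ℝ) :
    ∫ z, g (x + c * z) * z ∂gaussianReal 0 1 = c * gaussAvg c g' x := by
  have hgc : Continuous g := continuous_iff_continuousAt.2 fun t => (hg t).continuousAt
  have i0 : Integrable (fun z => g (x + c * z)) (gaussianReal 0 1) :=
    integrable_gauss_of_le (by fun_prop) (exp_abs_add_mul_le hb le_rfl le_rfl)
  have i1 : Integrable (fun z => g' (x + c * z)) (gaussianReal 0 1) :=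
    integrable_gauss_of_le (by fun_prop) (exp_abs_add_mul_le hb' le_rfl le_rfl)
  have i2 : Integrable (fun z => g (x + c * z) * z) (gaussianReal 0 1) :=
    integrable_gauss_of_le (C := C * Real.exp |x|) (k := |c| + 1) (by fun_prop) fun z => by
      rw [abs_mul]
      have hC : 0 ≤ C * Real.exp |x| := (abs_nonneg _).trans (hb x)
      calc _ ≤ C * Real.exp |x| * Real.exp (|c| * |z|) * |z| :=
            mul_le_mul_of_nonneg_right (exp_abs_add_mul_le hb le_rfl le_rfl z) (abs_nonneg z)
        _ ≤ _ := by
            rw [mul_assoc]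
            exact mul_le_mul_of_nonneg_left (abs_mul_exp_mul_le _ _) hC
  have hd : ∀ z, HasDerivAt (fun z => gaussianPDFReal 0 1 z * g (x + c * z))
      (c * (gaussianPDFReal 0 1 z * g' (x + c * z)) -
        gaussianPDFReal 0 1 z * (g (x + c * z) * z)) z := fun z => by
    have h1 : HasDerivAt (fun z => x + c * z) c z := by
      simpa using ((hasDerivAt_id z).const_mul c).const_add x
    refine ((hasDerivAt_gaussianPDFReal z).mul ((hg (x + c * z)).comp z h1)).congr_deriv ?_
    simp only [Function.comp]
    ring
  have j0 := integrable_iff_integrable_gaussianPDFReal_mul.1 i0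
  have j1 := integrable_iff_integrable_gaussianPDFReal_mul.1 i1
  have j2 := integrable_iff_integrable_gaussianPDFReal_mul.1 i2
  -- The density times g is integrable with integrable derivative, so that derivative has integral
  -- zero; differentiating the density contributes the factor -z.
  have := integral_eq_zero_of_hasDerivAt_of_integrable hd ((j1.const_mul c).sub j2) j0
  rw [integral_sub (j1.const_mul c) j2, integral_const_mul] at this
  rw [gaussAvg, integral_gaussianReal_eq_integral_smul one_ne_zero,
    integral_gaussianReal_eq_integral_smul one_ne_zero]
  simp only [smul_eq_mul]
  linarith

/-- `f` has the continuous derivatives `f'`, `f''`, all of at most exponential growth. -/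
structure ExpC2 (f f' f'' : ℝ → ℝ) : Prop where
  d1 : ∀ x, HasDerivAt f (f' x) x
  d2 : ∀ x, HasDerivAt f' (f'' x) x
  cont : Continuous f''
  bound : ∃ C, ∀ x, |f x| ≤ C * Real.exp |x| ∧ |f' x| ≤ C * Real.exp |x| ∧
    |f'' x| ≤ C * Real.exp |x|

theorem hasDerivAt_gaussAvg {g g' : ℝ → ℝ} (hg : ∀ x, HasDerivAt g (g' x) x)
    (hg' : Continuous g') {C : ℝ} (hb : ∀ y, |g y| ≤ C * Real.exp |y|)
    (hb' : ∀ y, |g' y| ≤ C * Real.exp |y|) (c x : ℝ) :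
    HasDerivAt (gaussAvg c g) (gaussAvg c g' x) x := by
  have hgc : Continuous g := continuous_iff_continuousAt.2 fun t => (hg t).continuousAt
  have hC : ∀ X, 0 ≤ C * Real.exp X := fun X => by
    have := (abs_nonneg _).trans (hb 0)
    simp at this
    positivity
  refine hasDerivAt_integral_gauss (F := fun x z => g (x + c * z))
    (F' := fun x z => g' (x + c * z)) (C := C * Real.exp (|x| + 1)) (k := |c|)
    (fun _ => by fun_prop) (fun _ => by fun_prop)
    (fun τ z => (hg (τ + c * z)).comp_add_const τ (c * z))
    (exp_abs_add_mul_le hb (by linarith) le_rfl) fun τ hτ => exp_abs_add_mul_le hb' ?_ le_rfl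
  rw [Metric.mem_ball, Real.dist_eq] at hτ
  linarith [abs_sub_abs_le_abs_sub τ x]

/-- Differentiation under the integral yields f' (x + c z) z, and integration by parts trades z for
a further derivative. This is the heat equation in the variable c, obtained without differentiating
the heat kernel. -/
theorem hasDerivAt_gaussAvg_scale {f f' f'' : ℝ → ℝ} (h : ExpC2 f f' f'') (c x : ℝ) :
    HasDerivAt (fun c => gaussAvg c f x) (c * gaussAvg c f'' x) c := by
  obtain ⟨C, hC⟩ := h.bound
  have hf : Continuous f := continuous_iff_continuousAt.2 fun t => (h.d1 t).continuousAt
  have hf' : Continuous f' := continuous_iff_continuousAt.2 fun t => (h.d2 t).continuousAt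
  have hC0 : 0 ≤ C * Real.exp |x| := (abs_nonneg _).trans (hC x).1
  rw [← integral_gauss_mul_eq h.d2 h.cont (fun y => (hC y).2.1) (fun y => (hC y).2.2)]
  refine hasDerivAt_integral_gauss (F := fun c z => f (x + c * z))
    (F' := fun c z => f' (x + c * z) * z) (C := C * Real.exp |x|) (k := |c| + 1 + 1)
    (fun _ => by fun_prop) (fun _ => by fun_prop) (fun τ z => ?_)
    (exp_abs_add_mul_le (fun y => (hC y).1) le_rfl (by linarith)) fun τ hτ z => ?_
  · have h1 : HasDerivAt (fun c => x + c * z) z τ := by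
      simpa using ((hasDerivAt_id τ).mul_const z).const_add x
    exact (h.d1 (x + τ * z)).comp τ h1
  · rw [Metric.mem_ball, Real.dist_eq] at hτ
    rw [abs_mul]
    calc _ ≤ C * Real.exp |x| * Real.exp ((|c| + 1) * |z|) * |z| :=
          mul_le_mul_of_nonneg_right (exp_abs_add_mul_le (fun y => (hC y).2.1) le_rfl
            (by linarith [abs_sub_abs_le_abs_sub τ c]) z) (abs_nonneg z)
      _ ≤ _ := by
          rw [mul_assoc]
          exact mul_le_mul_of_nonneg_left (abs_mul_exp_mul_le _ _) hC0

/-- The heat evolution with diffusion coefficient `a / 2`. -/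
noncomputable def heatFlow (a : ℝ) (f : ℝ → ℝ) (s x : ℝ) : ℝ := gaussAvg (√a * √s) f x

theorem continuous_heatFlow (a : ℝ) {f : ℝ → ℝ} (hf : Continuous f) {C : ℝ}
    (hb : ∀ y, |f y| ≤ C * Real.exp |y|) :
    Continuous fun p : ℝ × ℝ => heatFlow a f p.1 p.2 :=
  (continuous_gaussAvg hf hb).comp
    (show Continuous fun p : ℝ × ℝ => (√a * √p.1, p.2) by fun_prop)

theorem expGrowth_heatFlow (a : ℝ) {f : ℝ → ℝ} {C : ℝ} (hb : ∀ y, |f y| ≤ C * Real.exp |y|) :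
    ExpGrowth (heatFlow a f) := fun T => ⟨_, fun t ht x =>
  abs_gaussAvg_le hb (K := √a * √T) (by
    rw [abs_of_nonneg (by positivity)]
    exact mul_le_mul_of_nonneg_left (Real.sqrt_le_sqrt ht.2) (Real.sqrt_nonneg a)) x⟩

theorem heatFlow_zero (a : ℝ) (f : ℝ → ℝ) (x : ℝ) : heatFlow a f 0 x = f x := by
  simp [heatFlow, gaussAvg]

/-- The heat evolution is a classical solution of the heat equation. -/
theorem hasC12_heatFlow {a : ℝ} (ha : 0 ≤ a) {f f' f'' : ℝ → ℝ} (h : ExpC2 f f' f'') :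
    HasC12 (heatFlow a f) (fun s x => a / 2 * heatFlow a f'' s x) (heatFlow a f')
      (heatFlow a f'') := by
  obtain ⟨C, hC⟩ := h.bound
  have hf : Continuous f := continuous_iff_continuousAt.2 fun t => (h.d1 t).continuousAt
  have hf' : Continuous f' := continuous_iff_continuousAt.2 fun t => (h.d2 t).continuousAt
  refine ⟨fun s hs x => ?_, fun s _ x => hasDerivAt_gaussAvg h.d1 hf' (fun y => (hC y).1)
    (fun y => (hC y).2.1) _ x, fun s _ x => hasDerivAt_gaussAvg h.d2 h.cont (fun y => (hC y).2.1)
    (fun y => (hC y).2.2) _ x, ?_, ?_, ?_, ?_⟩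
  -- For c = √a √s the chain rule gives c · √a / (2 √s) = a / 2.
  · have h1 := (Real.hasDerivAt_sqrt hs.ne').const_mul √a
    refine ((hasDerivAt_gaussAvg_scale h (√a * √s) x).comp s h1).congr_deriv ?_
    have h2 : √s ≠ 0 := (Real.sqrt_pos.2 hs).ne'
    have h3 : √a * √a = a := Real.mul_self_sqrt ha
    rw [← heatFlow]
    field_simp
    rw [sq, h3, mul_comm]
  · exact (continuous_heatFlow a hf fun y => (hC y).1).continuousOn
  · exact (continuous_const.mul (continuous_heatFlow a h.cont fun y => (hC y).2.2)).continuousOn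
  · exact (continuous_heatFlow a hf' fun y => (hC y).2.1).continuousOn
  · exact (continuous_heatFlow a h.cont fun y => (hC y).2.2).continuousOn

/-- The heat evolution has right derivative `a f'' / 2` at time `0`. -/
theorem hasDerivWithinAt_heatFlow_zero {a : ℝ} (ha : 0 ≤ a) {f f' f'' : ℝ → ℝ}
    (h : ExpC2 f f' f'') (x : ℝ) :
    HasDerivWithinAt (fun s => heatFlow a f s x) (a / 2 * f'' x) (Ici 0) 0 := by
  obtain ⟨C, hC⟩ := h.bound
  have hf : Continuous f := continuous_iff_continuousAt.2 fun t => (h.d1 t).continuousAt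
  have H := hasC12_heatFlow ha h
  have c0 : Continuous fun s => heatFlow a f s x :=
    (continuous_heatFlow a hf fun y => (hC y).1).comp (by fun_prop : Continuous fun s => (s, x))
  have c2 : Continuous fun s => a / 2 * heatFlow a f'' s x := continuous_const.mul
    ((continuous_heatFlow a h.cont fun y => (hC y).2.2).comp
      (by fun_prop : Continuous fun s => (s, x)))
  -- The scale √s is not differentiable at 0, so the right derivative is found as the limit of the
  -- derivatives at s > 0.
  refine hasDerivWithinAt_Ici_of_tendsto_deriv (s := Ioi 0)
    (fun s hs => (H.dt s hs x).differentiableAt.differentiableWithinAt)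
    c0.continuousWithinAt self_mem_nhdsWithin ?_
  have h2 := (c2.tendsto 0).mono_left (nhdsWithin_le_nhds (s := Ioi 0))
  simp only [heatFlow_zero] at h2
  refine h2.congr' ?_
  filter_upwards [self_mem_nhdsWithin] with s hs using (H.deriv_t hs x).symm

/-! ### Box averages -/

/-- The average of `f` over `[x, x + η]`. -/
noncomputable def boxAvg (η : ℝ) (f : ℝ → ℝ) (x : ℝ) : ℝ := ∫ r in (0 : ℝ)..1, f (x + η * r)

/-- The average is 1 / η times an increment of a primitive of f, so each averaging gains one
derivative. -/
theorem hasDerivAt_boxAvg {f : ℝ → ℝ} (hf : Continuous f) {η : ℝ} (hη : η ≠ 0) (x : ℝ) :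
    HasDerivAt (boxAvg η f) ((f (x + η) - f x) / η) x := by
  have h1 : boxAvg η f = fun x => η⁻¹ * ((∫ y in (0 : ℝ)..(x + η), f y) - ∫ y in (0 : ℝ)..x, f y) := by
    funext x
    rw [boxAvg, intervalIntegral.integral_comp_add_mul _ hη,
      intervalIntegral.integral_interval_sub_left (hf.intervalIntegrable _ _)
        (hf.intervalIntegrable _ _)]
    simp
  have h2 : ∀ y, HasDerivAt (fun x => ∫ y in (0 : ℝ)..x, f y) (f y) y := fun y =>
    intervalIntegral.integral_hasDerivAt_right (hf.intervalIntegrable _ _)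
      (hf.stronglyMeasurableAtFilter _ _) hf.continuousAt
  rw [h1]
  refine ((((h2 (x + η)).comp_add_const x η).sub (h2 x)).const_mul η⁻¹).congr_deriv ?_
  ring

theorem abs_boxAvg_sub_le {f : ℝ → ℝ} (hf : Continuous f) {η x m e : ℝ}
    (h : ∀ r ∈ Icc (0 : ℝ) 1, |f (x + η * r) - m| ≤ e) : |boxAvg η f x - m| ≤ e := by
  have h1 : boxAvg η f x - m = ∫ r in (0 : ℝ)..1, (f (x + η * r) - m) := by
    rw [intervalIntegral.integral_sub
      (Continuous.intervalIntegrable (by fun_prop) _ _) (by simp)]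
    simp [boxAvg]
  rw [h1]
  have := intervalIntegral.norm_integral_le_of_norm_le_const (a := 0) (b := 1) (C := e)
    (f := fun r => f (x + η * r) - m) (fun r hr => h r (by
      rw [uIoc_of_le zero_le_one] at hr
      exact ⟨hr.1.le, hr.2⟩))
  simpa using this

/-- Continuous functions on the plane of at most exponential growth in `x`, uniformly for `t`
bounded above. -/
structure ContExpGrowth (w : ℝ → ℝ → ℝ) : Prop where
  cont : Continuous fun p : ℝ × ℝ => w p.1 p.2
  growth : ∀ T, ∃ C, ∀ t ≤ T, ∀ x, |w t x| ≤ C * Real.exp |x|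

namespace ContExpGrowth

variable {w : ℝ → ℝ → ℝ}

theorem cont_right (hw : ContExpGrowth w) (t : ℝ) : Continuous (w t) :=
  hw.cont.comp (by fun_prop : Continuous fun x : ℝ => (t, x))

theorem cont_left (hw : ContExpGrowth w) (x : ℝ) : Continuous fun t => w t x :=
  hw.cont.comp (by fun_prop : Continuous fun t : ℝ => (t, x))

theorem growth_nonneg (hw : ContExpGrowth w) (T : ℝ) : ∃ C, 0 ≤ C ∧ ∀ t ≤ T, ∀ x, |w t x| ≤ C * Real.exp |x| := by
  obtain ⟨C, hC⟩ := hw.growth T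
  refine ⟨C, ?_, hC⟩
  have := (abs_nonneg _).trans (hC T le_rfl 0)
  simpa using this

theorem expGrowth (hw : ContExpGrowth w) : ExpGrowth w := fun T => by
  obtain ⟨C, hC⟩ := hw.growth T
  exact ⟨C, fun t ht => hC t ht.2⟩

theorem comp_add (hw : ContExpGrowth w) (s y : ℝ) : ContExpGrowth fun t x => w (t + s) (x + y) where
  cont := hw.cont.comp (by fun_prop : Continuous fun p : ℝ × ℝ => (p.1 + s, p.2 + y))
  growth T := by
    obtain ⟨C, h0, hC⟩ := hw.growth_nonneg (T + s)
    refine ⟨C * Real.exp |y|, fun t ht x => (hC _ (by linarith) _).trans ?_⟩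
    rw [mul_assoc, ← Real.exp_add]
    refine mul_le_mul_of_nonneg_left (Real.exp_le_exp.2 ?_) h0
    linarith [abs_add_le x y]

theorem sub (hw : ContExpGrowth w) {v : ℝ → ℝ → ℝ} (hv : ContExpGrowth v) : ContExpGrowth fun t x => w t x - v t x where
  cont := hw.cont.sub hv.cont
  growth T := by
    obtain ⟨C, hC⟩ := hw.growth T
    obtain ⟨D, hD⟩ := hv.growth T
    refine ⟨C + D, fun t ht x => (abs_sub _ _).trans ?_⟩
    rw [add_mul]
    exact add_le_add (hC t ht x) (hD t ht x)

theorem div_const (hw : ContExpGrowth w) (c : ℝ) : ContExpGrowth fun t x => w t x / c where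
  cont := hw.cont.div_const c
  growth T := by
    obtain ⟨C, hC⟩ := hw.growth T
    refine ⟨C / |c|, fun t ht x => ?_⟩
    rw [abs_div, div_mul_eq_mul_div]
    exact div_le_div_of_nonneg_right (hC t ht x) (abs_nonneg c)

theorem boxAvg_right (hw : ContExpGrowth w) {η : ℝ} (hη : 0 ≤ η) : ContExpGrowth fun t => boxAvg η (w t) where
  cont := by
    have h : Continuous fun q : (ℝ × ℝ) × ℝ => w q.1.1 (q.1.2 + η * q.2) :=
      hw.cont.comp (by fun_prop : Continuous fun q : (ℝ × ℝ) × ℝ => (q.1.1, q.1.2 + η * q.2))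
    exact intervalIntegral.continuous_parametric_intervalIntegral_of_continuous'
      (f := fun (p : ℝ × ℝ) r => w p.1 (p.2 + η * r)) h 0 1
  growth T := by
    obtain ⟨C, h0, hC⟩ := hw.growth_nonneg T
    refine ⟨C * Real.exp η, fun t ht x => ?_⟩
    have := abs_boxAvg_sub_le (hw.cont_right t) (η := η) (x := x) (m := 0)
      (e := C * Real.exp η * Real.exp |x|) (fun r hr => by
        rw [sub_zero, mul_assoc, ← Real.exp_add]
        refine (hC t ht _).trans (mul_le_mul_of_nonneg_left (Real.exp_le_exp.2 ?_) h0)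
        have h1 := abs_add_le x (η * r)
        rw [abs_of_nonneg (mul_nonneg hη hr.1)] at h1
        nlinarith [hr.2])
    simpa using this

theorem boxAvg_left (hw : ContExpGrowth w) {η : ℝ} (hη : 0 ≤ η) :
    ContExpGrowth fun t x => boxAvg η (fun s => w s x) t where
  cont := by
    have h : Continuous fun q : (ℝ × ℝ) × ℝ => w (q.1.1 + η * q.2) q.1.2 :=
      hw.cont.comp (by fun_prop : Continuous fun q : (ℝ × ℝ) × ℝ => (q.1.1 + η * q.2, q.1.2))
    exact intervalIntegral.continuous_parametric_intervalIntegral_of_continuous'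
      (f := fun (p : ℝ × ℝ) r => w (p.1 + η * r) p.2) h 0 1
  growth T := by
    obtain ⟨C, h0, hC⟩ := hw.growth_nonneg (T + η)
    refine ⟨C, fun t ht x => ?_⟩
    have := abs_boxAvg_sub_le (hw.cont_left x) (η := η) (x := t) (m := 0)
      (e := C * Real.exp |x|) (fun r hr => by
        rw [sub_zero]
        exact hC _ (by nlinarith [hr.2]) _)
    simpa using this

theorem boxAvg_comm (hw : ContExpGrowth w) (η t x : ℝ) :
    boxAvg η (fun y => boxAvg η (fun s => w s y) t) x =
      boxAvg η (fun s => boxAvg η (w s) x) t := by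
  have h : Continuous (Function.uncurry fun r q : ℝ => w (t + η * q) (x + η * r)) :=
    hw.cont.comp (by fun_prop : Continuous fun p : ℝ × ℝ => (t + η * p.2, x + η * p.1))
  refine intervalIntegral_intervalIntegral_swap ?_
  rw [uIoc_of_le zero_le_one]
  exact (h.continuousOn.integrableOn_compact (isCompact_Icc.prod isCompact_Icc)).mono_set
    (prod_mono Ioc_subset_Icc_self Ioc_subset_Icc_self)

end ContExpGrowth

/-- Fubini; with it box averages commute with the heat semigroup. -/
theorem integral_gauss_intervalIntegral {F : ℝ → ℝ → ℝ} (hF : Continuous (Function.uncurry F)) {C k : ℝ}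
    (hC : ∀ r ∈ Icc (0 : ℝ) 1, ∀ z, |F r z| ≤ C * Real.exp (k * |z|)) :
    ∫ z, (∫ r in (0 : ℝ)..1, F r z) ∂gaussianReal 0 1 =
      ∫ r in (0 : ℝ)..1, (∫ z, F r z ∂gaussianReal 0 1) := by
  simp only [intervalIntegral.integral_of_le zero_le_one]
  refine integral_integral_swap (f := fun z r => F r z) ?_
  have h1 : Integrable (fun p : ℝ × ℝ => C * Real.exp (k * |p.1|))
      ((gaussianReal 0 1).prod (volume.restrict (Ioc (0 : ℝ) 1))) := by
    have := ((integrable_exp_mul_abs k).const_mul C).mul_prod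
      (integrable_const (1 : ℝ) (μ := volume.restrict (Ioc (0 : ℝ) 1)))
    simpa using this
  refine h1.mono' (hF.comp continuous_swap).aestronglyMeasurable ?_
  have h2 : ∀ᵐ p : ℝ × ℝ ∂((gaussianReal 0 1).prod (volume.restrict (Ioc (0 : ℝ) 1))),
      p.2 ∈ Ioc (0 : ℝ) 1 :=
    Measure.quasiMeasurePreserving_snd.ae (ae_restrict_mem measurableSet_Ioc)
  filter_upwards [h2] with p hp using hC p.2 ⟨hp.1.le, hp.2⟩ p.1

/-! ### Domination of a heat semigroup and its smoothing -/

/-- `w (t + s) ≥ P_s (w t)` for the heat semigroup `P` with diffusion coefficient `a / 2`. -/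
def HeatSuper (a : ℝ) (w : ℝ → ℝ → ℝ) : Prop :=
  ∀ t ≥ 0, ∀ s ≥ 0, ∀ x, heatFlow a (w t) s x ≤ w (t + s) x

/-- The heat flow commutes with translations in x, so the inequality at the points x + η r can be
integrated over r. -/
theorem HeatSuper.boxAvg_right {a : ℝ} {w : ℝ → ℝ → ℝ} (h : HeatSuper a w)
    (hw : ContExpGrowth w) {η : ℝ} (hη : 0 ≤ η) : HeatSuper a fun t => boxAvg η (w t) := by
  intro t ht s hs x
  obtain ⟨C, hC⟩ := hw.growth t
  set c := √a * √s with hc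
  have hwt := hw.cont_right t
  have hb : ∀ r ∈ Icc (0 : ℝ) 1, ∀ z, |w t (x + c * z + η * r)| ≤
      C * Real.exp (|x| + η) * Real.exp (|c| * |z|) := fun r hr z => by
    have hx : |x + η * r| ≤ |x| + η := by
      have h1 := abs_add_le x (η * r)
      rw [abs_of_nonneg (mul_nonneg hη hr.1)] at h1
      nlinarith [hr.2]
    have := exp_abs_add_mul_le (hC t le_rfl) hx (le_refl |c|) z
    rwa [add_right_comm] at this
  have e : heatFlow a (boxAvg η (w t)) s x = boxAvg η (heatFlow a (w t) s) x := by
    have := integral_gauss_intervalIntegral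
      (F := fun r z => w t (x + c * z + η * r)) (by fun_prop) hb
    simp only [add_right_comm] at this
    simpa only [heatFlow, gaussAvg, boxAvg, add_right_comm] using this
  rw [e]
  have hc1 : Continuous fun y => heatFlow a (w t) s y :=
    (continuous_heatFlow a hwt (hC t le_rfl)).comp (by fun_prop : Continuous fun y : ℝ => (s, y))
  refine intervalIntegral.integral_mono_on zero_le_one
    (Continuous.intervalIntegrable (by fun_prop) _ _)
    (((hw.cont_right (t + s)).comp (by fun_prop :
      Continuous fun r => x + η * r)).intervalIntegrable _ _) fun r _ => h t ht s hs _

/-- The inequality from each starting time t + η r is integrated over r. Averaging forward keeps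
these times nonnegative. -/
theorem HeatSuper.boxAvg_left {a : ℝ} {w : ℝ → ℝ → ℝ} (h : HeatSuper a w)
    (hw : ContExpGrowth w) {η : ℝ} (hη : 0 ≤ η) :
    HeatSuper a fun t x => boxAvg η (fun s => w s x) t := by
  intro t ht s hs x
  obtain ⟨C, hC⟩ := hw.growth (t + η)
  set c := √a * √s with hc
  have hwc : Continuous (Function.uncurry fun r z : ℝ => w (t + η * r) (x + c * z)) :=
    hw.cont.comp (by fun_prop : Continuous fun p : ℝ × ℝ => (t + η * p.1, x + c * p.2))
  have hb : ∀ r ≤ 1, ∀ z, |w (t + η * r) (x + c * z)| ≤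
      C * Real.exp |x| * Real.exp (|c| * |z|) := fun r hr z =>
    exp_abs_add_mul_le (hC _ (by nlinarith)) le_rfl le_rfl z
  have e : heatFlow a (fun y => boxAvg η (fun s => w s y) t) s x =
      boxAvg η (fun q => heatFlow a (w q) s x) t :=
    integral_gauss_intervalIntegral hwc fun r hr => hb r hr.2
  rw [e]
  have hc1 : Continuous fun q => heatFlow a (w q) s x := by
    refine continuous_iff_continuousAt.2 fun q => ?_
    obtain ⟨D, hD⟩ := hw.growth (q + 1)
    refine continuousAt_integral_gauss (F := fun q z => w q (x + c * z))
      (C := D * Real.exp |x|) (k := |c|)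
      (hw.cont.comp (by fun_prop : Continuous fun p : ℝ × ℝ => (p.1, x + c * p.2))) ?_
    filter_upwards [eventually_lt_nhds (show q < q + 1 by linarith)] with p hp z using
      exp_abs_add_mul_le (hD _ hp.le) le_rfl le_rfl z
  refine intervalIntegral.integral_mono_on zero_le_one
    ((hc1.comp (by fun_prop : Continuous fun r => t + η * r)).intervalIntegrable _ _) ?_ fun r hr =>
      (h (t + η * r) (add_nonneg ht (mul_nonneg hη hr.1)) s hs x).trans_eq (by ring_nf)
  exact ((hw.cont_left x).comp (by fun_prop :
    Continuous fun r => t + s + η * r)).intervalIntegrable _ _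

/-- Averages of `w` over boxes of side `η`, once in `t` and twice in `x`. -/
noncomputable def boxSmooth (η : ℝ) (w : ℝ → ℝ → ℝ) (t : ℝ) : ℝ → ℝ :=
  boxAvg η (boxAvg η fun y => boxAvg η (fun s => w s y) t)

/-- Fubini moves the time average outermost, where it can be differentiated in t. -/
theorem boxSmooth_eq {w : ℝ → ℝ → ℝ} (hw : ContExpGrowth w) {η : ℝ} (hη : 0 ≤ η) (t x : ℝ) :
    boxSmooth η w t x = boxAvg η (fun s => boxAvg η (boxAvg η (w s)) x) t := by
  rw [← (hw.boxAvg_right hη).boxAvg_comm, boxSmooth]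
  congr 1
  exact funext fun y => hw.boxAvg_comm η t y

theorem contExpGrowth_boxSmooth {w : ℝ → ℝ → ℝ} (hw : ContExpGrowth w) {η : ℝ} (hη : 0 ≤ η) :
    ContExpGrowth (boxSmooth η w) := ((hw.boxAvg_left hη).boxAvg_right hη).boxAvg_right hη

theorem HeatSuper.boxSmooth {a : ℝ} {w : ℝ → ℝ → ℝ} (h : HeatSuper a w) (hw : ContExpGrowth w)
    {η : ℝ} (hη : 0 ≤ η) : HeatSuper a (boxSmooth η w) :=
  ((h.boxAvg_left hw hη).boxAvg_right (hw.boxAvg_left hη) hη).boxAvg_right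
    ((hw.boxAvg_left hη).boxAvg_right hη) hη

/-- `boxSmooth η w` is of class `C^{1,2}` with derivatives of at most exponential growth. -/
theorem exists_hasDerivAt_boxSmooth {w : ℝ → ℝ → ℝ} (hw : ContExpGrowth w) {η : ℝ} (hη : 0 < η) :
    ∃ Wt Wx Wxx : ℝ → ℝ → ℝ, ContExpGrowth Wt ∧ ContExpGrowth Wx ∧ ContExpGrowth Wxx ∧
      (∀ t x, HasDerivAt (fun s => boxSmooth η w s x) (Wt t x) t) ∧
      (∀ t x, HasDerivAt (boxSmooth η w t) (Wx t x) x) ∧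
      ∀ t x, HasDerivAt (Wx t) (Wxx t x) x := by
  have hV := hw.boxAvg_left hη.le
  have hV1 := hV.boxAvg_right hη.le
  have hU := (hw.boxAvg_right hη.le).boxAvg_right hη.le
  refine ⟨_, _, _, ((hU.comp_add η 0).sub hU).div_const η,
    ((hV1.comp_add 0 η).sub hV1).div_const η,
    ((((hV.comp_add 0 η).sub hV).div_const η).comp_add 0 η |>.sub
      (((hV.comp_add 0 η).sub hV).div_const η)).div_const η, fun t x => ?_, fun t x => ?_,
      fun t x => ?_⟩
  · simp only [boxSmooth_eq hw hη.le, add_zero]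
    exact hasDerivAt_boxAvg (hU.cont_left x) hη.ne' t
  · simp only [add_zero]
    exact hasDerivAt_boxAvg (hV1.cont_right t) hη.ne' x
  · have h1 := fun y => hasDerivAt_boxAvg (hV.cont_right t) hη.ne' y
    simp only [add_zero]
    exact (((h1 (x + η)).comp_add_const x η).sub (h1 x)).div_const η

/-- Classical form of `HeatSuper`. -/
theorem HeatSuper.le_deriv {a : ℝ} (ha : 0 ≤ a) {w : ℝ → ℝ → ℝ} (h : HeatSuper a w) {t : ℝ}
    (ht : 0 ≤ t) {f' f'' : ℝ → ℝ} (hw : ExpC2 (w t) f' f'') {x wt : ℝ}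
    (hd : HasDerivAt (fun s => w s x) wt t) : a / 2 * f'' x ≤ wt := by
  have h1 : HasDerivAt (fun s => w (t + s) x) wt 0 := by
    refine HasDerivAt.comp_const_add (f := fun s => w s x) t 0 ?_
    rwa [add_zero]
  -- The difference of w (t + s) x and the heat flow of w t vanishes at s = 0 and is nonnegative for
  -- s > 0, so its right derivative is nonnegative.
  have h2 := h1.hasDerivWithinAt.sub (hasDerivWithinAt_heatFlow_zero ha hw x)
  rw [hasDerivWithinAt_iff_tendsto_slope] at h2
  have : 0 ≤ wt - a / 2 * f'' x := by
    have hne : (𝓝[Ici (0 : ℝ) \ {0}] (0 : ℝ)).NeBot := by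
      rw [show Ici (0 : ℝ) \ {0} = Ioi 0 from Ici_sdiff_left]; infer_instance
    refine ge_of_tendsto h2 ?_
    filter_upwards [self_mem_nhdsWithin] with s hs
    have hs0 : 0 ≤ s := hs.1
    have := h t ht s hs0 x
    rw [slope_def_field]
    simp only [Pi.sub_apply, add_zero, heatFlow_zero, sub_self, sub_zero]
    exact div_nonneg (by linarith) hs0
  linarith

/-- Bounded x is handled by uniform continuity on a compact rectangle; for large |x| the growth of w
is absorbed by cosh (2x), the weight that the comparison tolerates. -/
theorem ContExpGrowth.exists_abs_sub_le {w : ℝ → ℝ → ℝ} (hw : ContExpGrowth w) (T : ℝ) {ε : ℝ}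
    (hε : 0 < ε) : ∃ δ > 0, ∀ t ∈ Icc 0 T, ∀ τ ∈ Icc 0 δ, ∀ y ∈ Icc 0 δ, ∀ x,
      |w (t + τ) (x + y) - w t x| ≤ ε * Real.cosh (2 * x) := by
  obtain ⟨C, h0, hC⟩ := hw.growth_nonneg (T + 1)
  obtain ⟨R, hR, hRx⟩ := exists_exp_le_cosh (C * (Real.exp 1 + 1)) hε
  have hcomp : IsCompact (Icc 0 (T + 1) ×ˢ Icc (-(R + 1)) (R + 1)) :=
    isCompact_Icc.prod isCompact_Icc
  have huc := hcomp.uniformContinuousOn_of_continuous hw.cont.continuousOn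
  obtain ⟨δ, hδ, hδ'⟩ := Metric.uniformContinuousOn_iff.1 huc ε hε
  refine ⟨min 1 (δ / 2), by positivity, fun t ht τ hτ y hy x => ?_⟩
  have hτ1 := hτ.2.trans (min_le_left _ _)
  have hτ2 := hτ.2.trans (min_le_right _ _)
  have hy1 := hy.2.trans (min_le_left _ _)
  have hy2 := hy.2.trans (min_le_right _ _)
  rcases le_total R |x| with hx | hx
  · refine le_trans ?_ (hRx x hx)
    refine (abs_sub _ _).trans ?_
    have h1 := hC (t + τ) (by linarith [ht.2]) (x + y)
    have h2 := hC t (by linarith [ht.2]) x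
    have h3 : Real.exp |x + y| ≤ Real.exp 1 * Real.exp |x| := by
      rw [← Real.exp_add]
      refine Real.exp_le_exp.2 ?_
      have := abs_add_le x y
      rw [abs_of_nonneg hy.1] at this
      linarith
    have h4 := mul_le_mul_of_nonneg_left h3 h0
    linarith
  · have hx' := abs_le.1 hx
    have := hδ' (t + τ, x + y)
      ⟨⟨add_nonneg ht.1 hτ.1, by simpa using add_le_add ht.2 hτ1⟩,
        by show -(R + 1) ≤ x + y; linarith [hy.1], by show x + y ≤ R + 1; linarith⟩ (t, x)
      ⟨⟨ht.1, by show t ≤ T + 1; linarith [ht.2]⟩,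
        by show -(R + 1) ≤ x; linarith, by show x ≤ R + 1; linarith⟩ (by
          rw [Prod.dist_eq, Real.dist_eq, Real.dist_eq]
          simp only [add_sub_cancel_left, abs_of_nonneg hτ.1, abs_of_nonneg hy.1]
          exact max_lt (by linarith) (by linarith))
    rw [Real.dist_eq] at this
    have := Real.one_le_cosh (2 * x)
    nlinarith

theorem exists_abs_boxSmooth_sub_le {w : ℝ → ℝ → ℝ} (hw : ContExpGrowth w) (T : ℝ) {ε : ℝ}
    (hε : 0 < ε) : ∃ η > 0, ∀ t ∈ Icc 0 T, ∀ x,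
      |boxSmooth η w t x - w t x| ≤ ε * Real.cosh (2 * x) := by
  obtain ⟨δ, hδ, h⟩ := hw.exists_abs_sub_le T hε
  -- Two averages in x shift by at most twice the side of the box, hence the side δ / 2.
  have hη : 0 ≤ δ / 2 := by positivity
  have hV := hw.boxAvg_left hη
  have hV1 := hV.boxAvg_right hη
  refine ⟨δ / 2, by positivity, fun t ht x => ?_⟩
  refine abs_boxAvg_sub_le (hV1.cont_right t) fun r₁ h₁ => ?_
  refine abs_boxAvg_sub_le (hV.cont_right t) fun r₂ h₂ => ?_
  refine abs_boxAvg_sub_le (hw.cont_left _) fun r₃ h₃ => ?_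
  rw [add_assoc x]
  refine h t ht _ ⟨mul_nonneg hη h₃.1, by nlinarith [h₃.2]⟩ _
    ⟨add_nonneg (mul_nonneg hη h₁.1) (mul_nonneg hη h₂.1), by nlinarith [h₁.2, h₂.2]⟩ x

theorem ContExpGrowth.expC2_boxSmooth {w Wx Wxx : ℝ → ℝ → ℝ} {η : ℝ} (hη : 0 ≤ η)
    (hw : ContExpGrowth w) (hx : ContExpGrowth Wx) (hxx : ContExpGrowth Wxx)
    (dx : ∀ t x, HasDerivAt (boxSmooth η w t) (Wx t x) x)
    (dxx : ∀ t x, HasDerivAt (Wx t) (Wxx t x) x) (t : ℝ) :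
    ExpC2 (boxSmooth η w t) (Wx t) (Wxx t) where
  d1 := dx t
  d2 := dxx t
  cont := hxx.cont_right t
  bound := by
    obtain ⟨C₀, h₀⟩ := (contExpGrowth_boxSmooth hw hη).growth t
    obtain ⟨C₁, h₁⟩ := hx.growth t
    obtain ⟨C₂, h₂⟩ := hxx.growth t
    have key : ∀ C ≤ max C₀ (max C₁ C₂), ∀ x, C * Real.exp |x| ≤
        max C₀ (max C₁ C₂) * Real.exp |x| := fun C hC x =>
      mul_le_mul_of_nonneg_right hC (Real.exp_pos _).le
    exact ⟨max C₀ (max C₁ C₂), fun x => ⟨(h₀ t le_rfl x).trans (key _ (le_max_left _ _) x),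
      (h₁ t le_rfl x).trans (key _ ((le_max_left _ _).trans (le_max_right _ _)) x),
      (h₂ t le_rfl x).trans (key _ ((le_max_right _ _).trans (le_max_right _ _)) x)⟩⟩

theorem cosh_le_exp_abs (x : ℝ) : Real.cosh x ≤ Real.exp |x| := by
  rw [← Real.cosh_abs, Real.cosh_eq]
  have : Real.exp (-|x|) ≤ Real.exp |x| := Real.exp_le_exp.2 (by linarith [abs_nonneg x])
  linarith

theorem IsSubSol.comp_add {F : ℝ → ℝ} {u : ℝ → ℝ → ℝ} (hu : IsSubSol F u) {t₀ : ℝ} (ht₀ : 0 ≤ t₀) :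
    IsSubSol F (fun t x => u (t₀ + t) x) := by
  simpa using hu.comp_affine one_pos ht₀ (r := 1) (by norm_num)

/-- A viscosity supersolution of the heat equation dominates the heat semigroup. -/
theorem heatSuper_of_isSubSol_neg {a : ℝ} (ha : 0 ≤ a) {w : ℝ → ℝ → ℝ} (hw : ContExpGrowth w)
    (h : IsSubSol (fun X => a / 2 * X) fun t x => -w t x) : HeatSuper a w := by
  intro t₀ ht₀ s hs x
  set c := √a * √s with hc
  -- The total error per unit of ε: that of smoothing the initial value, carried along by the heat
  -- flow, and that of the barrier.
  set B := (∫ z, Real.cosh (2 * (x + c * z)) ∂gaussianReal 0 1) +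
    Real.exp ((4 * (a / 2) + 1) * s) * Real.cosh (2 * x) with hB
  have hcosh : Integrable (fun z => Real.cosh (2 * (x + c * z))) (gaussianReal 0 1) := by
    refine integrable_gauss_of_le (C := Real.exp (2 * |x|)) (k := 2 * |c|) (by fun_prop) fun z => ?_
    rw [abs_of_pos (Real.cosh_pos _), ← Real.exp_add]
    refine (cosh_le_exp_abs _).trans (Real.exp_le_exp.2 ?_)
    rw [abs_mul, abs_two]
    have := abs_add_le x (c * z)
    rw [abs_mul] at this
    linarith
  have hBpos : 0 < B := by
    refine add_pos_of_nonneg_of_pos (integral_nonneg fun z => (Real.cosh_pos _).le) ?_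
    have := Real.cosh_pos (2 * x)
    positivity
  obtain ⟨C, hC⟩ := hw.growth t₀
  have hneg : ContExpGrowth fun t x => -w t x :=
    ⟨hw.cont.neg, fun T => by simpa only [abs_neg] using hw.growth T⟩
  refine le_of_forall_pos_le_add fun ε' hε' => ?_
  set ε := ε' / B with hε
  have hεpos : 0 < ε := by positivity
  -- Only the slice at t₀ of the smoothing is used: its heat flow is a classical solution with which
  -- w can be compared.
  obtain ⟨η, hη, hηw⟩ := exists_abs_boxSmooth_sub_le hw t₀ hεpos
  obtain ⟨Wt, Wx, Wxx, ct, cx, cxx, dt, dx, dxx⟩ := exists_hasDerivAt_boxSmooth hw hη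
  have hf := hw.expC2_boxSmooth hη.le cx cxx dx dxx t₀
  set f := boxSmooth η w t₀ with hf_def
  have hclose := fun y => abs_le.1 (hηw t₀ ⟨ht₀, le_rfl⟩ y)
  obtain ⟨D, hD⟩ := hf.bound
  have hfc : Continuous f := continuous_iff_continuousAt.2 fun t => (hf.d1 t).continuousAt
  have hu := hneg.comp_add t₀ 0
  simp only [add_zero, add_comm _ t₀] at hu
  have key := IsSubSol.le_of_classical (Λ := a / 2) (by positivity)
    (fun X p _ => (mul_add (a / 2) X p).le) (h.comp_add ht₀) hu.cont.continuousOn hu.expGrowth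
    (hasC12_heatFlow ha hf).neg (continuous_heatFlow a hfc fun y => (hD y).1).neg.continuousOn
    (fun T => by
      simpa only [abs_neg] using expGrowth_heatFlow a (fun y => (hD y).1) T)
    (fun t _ y => by rw [mul_neg]) hεpos
    (fun y => by
      rw [add_zero, heatFlow_zero]
      linarith [(hclose y).2]) hs x
  have h2 : heatFlow a (w t₀) s x - ε * (∫ z, Real.cosh (2 * (x + c * z)) ∂gaussianReal 0 1) ≤
      heatFlow a f s x := by
    rw [← integral_const_mul]
    have i1 : Integrable (fun z => w t₀ (x + c * z)) (gaussianReal 0 1) :=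
      integrable_gauss_of_le ((hw.cont_right t₀).comp (by fun_prop : Continuous fun z => x + c * z))
        (exp_abs_add_mul_le (hC t₀ le_rfl) le_rfl le_rfl)
    have i2 : Integrable (fun z => f (x + c * z)) (gaussianReal 0 1) :=
      integrable_gauss_of_le (by fun_prop) (exp_abs_add_mul_le (fun y => (hD y).1) le_rfl le_rfl)
    have := integral_mono (i1.sub (hcosh.const_mul ε)) i2 fun z => by
      have := (hclose (x + c * z)).1
      simp only [Pi.sub_apply]
      linarith
    rwa [integral_sub' i1 (hcosh.const_mul ε)] at this
  have h3 : ε * B = ε' := div_mul_cancel₀ _ hBpos.ne'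
  rw [hB, mul_add] at h3
  linarith

/-! ### Comparison for the G-heat equation -/

theorem gFun_eq_max {vl vu : ℝ} (h : vl ≤ vu) (X : ℝ) :
    gFun vl vu X = max (vl / 2 * X) (vu / 2 * X) := by
  rw [gFun]
  rcases le_total 0 X with hX | hX
  · rw [max_eq_left hX, max_eq_right (by linarith : -X ≤ 0), max_eq_right (by nlinarith)]
    ring
  · rw [max_eq_right hX, max_eq_left (by linarith : 0 ≤ -X), max_eq_left (by nlinarith)]
    ring

theorem IsSubSol.congr {F : ℝ → ℝ} {u v : ℝ → ℝ → ℝ} (hu : IsSubSol F u)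
    (h : ∀ t > 0, ∀ x, u t x = v t x) : IsSubSol F v := by
  intro ψ hψ t ht x hx
  refine hu ψ hψ t ht x (hx.congr ?_)
  have : ∀ᶠ p : ℝ × ℝ in 𝓝 (t, x), 0 < p.1 :=
    continuous_fst.continuousAt.eventually (eventually_gt_nhds (show (0 : ℝ) < (t, x).1 from ht))
  filter_upwards [this] with p hp
  rw [h _ hp]

/-- Comparison principle for the `G`-heat equation: a viscosity subsolution lies below a viscosity
supersolution. -/
theorem IsSubSol.le_of_isSubSol_neg {vl vu : ℝ} (hvl : 0 ≤ vl) (hv : vl ≤ vu) {u w : ℝ → ℝ → ℝ}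
    (hu : IsSubSol (gFun vl vu) u)
    (huc : ContinuousOn (fun p : ℝ × ℝ => u p.1 p.2) (Ici 0 ×ˢ univ)) (hug : ExpGrowth u)
    (hw : IsSubSol (fun X => -gFun vl vu (-X)) fun t x => -w t x)
    (hwc : ContinuousOn (fun p : ℝ × ℝ => w p.1 p.2) (Ici 0 ×ˢ univ)) (hwg : ExpGrowth w)
    (h0 : ∀ x, u 0 x ≤ w 0 x) {t : ℝ} (ht : 0 ≤ t) (x : ℝ) : u t x ≤ w t x := by
  -- Freezing w at negative times makes it continuous on the whole plane, as the averaging lemmas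
  -- require.
  set w' : ℝ → ℝ → ℝ := fun t x => w (max t 0) x with hw'_def
  have hw' : ContExpGrowth w' := by
    refine ⟨hwc.comp_continuous (f := fun p : ℝ × ℝ => (max p.1 0, p.2)) (by fun_prop)
      fun p => ⟨le_max_right p.1 0, mem_univ _⟩, fun T => ?_⟩
    obtain ⟨C, hC⟩ := hwg (max T 0)
    exact ⟨C, fun t ht x => hC _ ⟨le_max_right _ _, max_le_max_right 0 ht⟩ x⟩
  have hsub : IsSubSol (fun X => -gFun vl vu (-X)) fun t x => -w' t x :=
    hw.congr fun t ht x => by simp only [hw'_def, max_eq_left ht.le]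
  -- A linear function below G turns a supersolution for G into one of the corresponding heat
  -- equation.
  have H : ∀ a, 0 ≤ a → (∀ X, a / 2 * X ≤ gFun vl vu X) → HeatSuper a w' := fun a ha hX =>
    heatSuper_of_isSubSol_neg ha hw' (hsub.mono fun X => by linarith [hX (-X)])
  have Hl := H vl hvl fun X => by rw [gFun_eq_max hv]; exact le_max_left _ _
  have Hu := H vu (hvl.trans hv) fun X => by rw [gFun_eq_max hv]; exact le_max_right _ _
  set B := Real.cosh (2 * x) + Real.exp ((4 * (vu / 2) + 1) * t) * Real.cosh (2 * x) with hB
  have hBpos : 0 < B := by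
    have := Real.cosh_pos (2 * x)
    positivity
  refine le_of_forall_pos_le_add fun ε' hε' => ?_
  set ε := ε' / B with hε
  have hεpos : 0 < ε := by positivity
  obtain ⟨η, hη, hηw⟩ := exists_abs_boxSmooth_sub_le hw' t hεpos
  obtain ⟨Wt, Wx, Wxx, ct, cx, cxx, dt, dx, dxx⟩ := exists_hasDerivAt_boxSmooth hw' hη
  have hW := contExpGrowth_boxSmooth hw' hη.le
  have key := IsSubSol.le_of_classical (Λ := vu / 2) (by linarith)
    (fun X p hp => by
      rw [gFun_eq_max hv, gFun_eq_max hv, max_add]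
      exact max_le_max (by nlinarith) (by nlinarith)) hu huc hug
    ⟨fun t _ => dt t, fun t _ => dx t, fun t _ => dxx t, hW.cont.continuousOn,
      ct.cont.continuousOn, cx.cont.continuousOn, cxx.cont.continuousOn⟩
    hW.cont.continuousOn hW.expGrowth
    (fun s hs y => by
      rw [gFun_eq_max hv]
      have hE := hw'.expC2_boxSmooth hη.le cx cxx dx dxx s
      -- Both heat inequalities hold classically for the average, hence so does the one for their
      -- maximum G.
      exact max_le ((Hl.boxSmooth hw' hη.le).le_deriv hvl hs.le hE (dt s y))
        ((Hu.boxSmooth hw' hη.le).le_deriv (hvl.trans hv) hs.le hE (dt s y))) hεpos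
    (fun y => by
      have h1 := (abs_le.1 (hηw 0 ⟨le_rfl, ht⟩ y)).1
      have h2 : w' 0 y = w 0 y := by simp [hw'_def]
      linarith [h0 y]) ht x
  have h1 := (abs_le.1 (hηw t ⟨ht, le_rfl⟩ x)).2
  have h2 : w' t x = w t x := by simp only [hw'_def, max_eq_left ht]
  have h3 : ε * B = ε' := div_mul_cancel₀ _ hBpos.ne'
  rw [hB, mul_add] at h3
  linarith

/-! ### The class C_{l,lip} -/

theorem pow_le_one_add_pow {a : ℝ} (ha : 0 ≤ a) {j k : ℕ} (h : j ≤ k) : a ^ j ≤ 1 + a ^ k := by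
  rcases le_total a 1 with h1 | h1
  · linarith [pow_le_one₀ ha h1 (n := j), pow_nonneg ha k]
  · linarith [pow_le_pow_right₀ h1 h]

theorem add_pow_le_two_pow {a b : ℝ} (ha : 0 ≤ a) (hb : 0 ≤ b) (m : ℕ) :
    (a + b) ^ m ≤ 2 ^ m * (a ^ m + b ^ m) :=
  (add_pow_le ha hb m).trans (mul_le_mul_of_nonneg_right
    (pow_le_pow_right₀ (by norm_num) (Nat.sub_le m 1)) (by positivity))

namespace IsClLip

variable {U V : Type*} [NormedAddCommGroup U] [NormedAddCommGroup V]

theorem nonneg_const {φ : V → ℝ} (h : IsClLip φ) : ∃ (C : ℝ) (m : ℕ), 0 ≤ C ∧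
    ∀ x y : V, |φ x - φ y| ≤ C * (1 + ‖x‖ ^ m + ‖y‖ ^ m) * ‖x - y‖ := by
  obtain ⟨C, m, h⟩ := h
  refine ⟨|C|, m, abs_nonneg C, fun x y => (h x y).trans ?_⟩
  gcongr
  exact le_abs_self C

theorem exists_bound {φ : V → ℝ} (h : IsClLip φ) : ∃ (C : ℝ) (m : ℕ), 0 ≤ C ∧
    ∀ x, |φ x| ≤ C * (1 + ‖x‖ ^ m) := by
  obtain ⟨C, m, hC, h⟩ := h.nonneg_const
  refine ⟨|φ 0| + 3 * C, m + 1, by positivity, fun x => ?_⟩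
  have h1 := h x 0
  rw [sub_zero, norm_zero] at h1
  have h2 : (0 : ℝ) ^ m ≤ 1 := pow_le_one₀ le_rfl zero_le_one
  have h3 : ‖x‖ ≤ 1 + ‖x‖ ^ (m + 1) := by
    simpa using pow_le_one_add_pow (norm_nonneg x) (show 1 ≤ m + 1 by omega)
  have h4 : C * (1 + ‖x‖ ^ m + 0 ^ m) * ‖x‖ ≤ C * (3 * (1 + ‖x‖ ^ (m + 1))) := by
    rw [mul_assoc]
    refine mul_le_mul_of_nonneg_left ?_ hC
    rw [pow_succ] at h3 ⊢
    nlinarith [norm_nonneg x]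
  have h5 : |φ x| ≤ |φ x - φ 0| + |φ 0| := by
    have := abs_add_le (φ x - φ 0) (φ 0)
    rwa [sub_add_cancel] at this
  have h6 : 0 ≤ |φ 0| * ‖x‖ ^ (m + 1) := by positivity
  nlinarith

theorem continuous {φ : V → ℝ} (h : IsClLip φ) : Continuous φ := by
  obtain ⟨C, m, hC, h⟩ := h.nonneg_const
  refine continuous_iff_continuousAt.2 fun x => ?_
  have h1 : Continuous fun y : V => C * (1 + ‖y‖ ^ m + ‖x‖ ^ m) * ‖y - x‖ := by fun_prop
  have h2 := h1.tendsto x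
  rw [sub_self, norm_zero, mul_zero] at h2
  exact tendsto_iff_dist_tendsto_zero.2
    (squeeze_zero (fun _ => dist_nonneg) (fun y => by rw [Real.dist_eq]; exact h y x) h2)

theorem comp_lipschitz {φ : V → ℝ} (h : IsClLip φ) {f : U → V} {L : ℝ}
    (hf : ∀ x y, ‖f x - f y‖ ≤ L * ‖x - y‖) (hL : 0 ≤ L) : IsClLip fun x => φ (f x) := by
  obtain ⟨C, m, hC, h⟩ := h.nonneg_const
  set A := ‖f 0‖ with hA
  have hb : ∀ x, ‖f x‖ ^ m ≤ 2 ^ m * (A ^ m + L ^ m * ‖x‖ ^ m) := fun x => by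
    have h1 : ‖f x‖ ≤ A + L * ‖x‖ := by
      have h2 := hf x 0
      rw [sub_zero] at h2
      have := norm_add_le (f x - f 0) (f 0)
      rw [sub_add_cancel] at this
      linarith
    rw [← mul_pow]
    exact (pow_le_pow_left₀ (norm_nonneg _) h1 m).trans
      (add_pow_le_two_pow (norm_nonneg _) (by positivity) m)
  set D := 1 + 2 ^ m * (2 * A ^ m + L ^ m) with hD
  refine ⟨C * D * L, m, fun x y => (h _ _).trans ?_⟩
  have hA0 : 0 ≤ A := norm_nonneg _
  have h1 : 1 + ‖f x‖ ^ m + ‖f y‖ ^ m ≤ D * (1 + ‖x‖ ^ m + ‖y‖ ^ m) := by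
    have e : D * (1 + ‖x‖ ^ m + ‖y‖ ^ m) = 1 + 2 ^ m * (A ^ m + L ^ m * ‖x‖ ^ m) +
        2 ^ m * (A ^ m + L ^ m * ‖y‖ ^ m) + (2 ^ m * L ^ m + (1 + 2 ^ m * (2 * A ^ m)) *
        (‖x‖ ^ m + ‖y‖ ^ m)) := by rw [hD]; ring
    have : 0 ≤ 2 ^ m * L ^ m + (1 + 2 ^ m * (2 * A ^ m)) * (‖x‖ ^ m + ‖y‖ ^ m) := by positivity
    linarith [hb x, hb y]
  calc C * (1 + ‖f x‖ ^ m + ‖f y‖ ^ m) * ‖f x - f y‖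
      ≤ C * (D * (1 + ‖x‖ ^ m + ‖y‖ ^ m)) * (L * ‖x - y‖) := by
        gcongr
        exact hf x y
    _ = _ := by ring

theorem comp_affine {φ : ℝ → ℝ} (h : IsClLip φ) (x d : ℝ) : IsClLip fun y => φ (x + d * y) :=
  h.comp_lipschitz (L := |d|) (fun y z => by
    rw [add_sub_add_left_eq_sub, ← mul_sub, norm_mul, Real.norm_eq_abs d]) (abs_nonneg d)

end IsClLip

/-- Puts the absolute moments that control all later error terms within reach of the expectation. -/
theorem isClLip_norm_pow {V : Type*} [NormedAddCommGroup V] (k : ℕ) :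
    IsClLip fun x : V => ‖x‖ ^ k := by
  refine ⟨k, k - 1, fun x y => ?_⟩
  refine (abs_pow_sub_pow_le ‖x‖ ‖y‖ k).trans ?_
  rw [abs_norm, abs_norm]
  have h1 : (max ‖x‖ ‖y‖) ^ (k - 1) ≤ 1 + ‖x‖ ^ (k - 1) + ‖y‖ ^ (k - 1) := by
    have := pow_nonneg (norm_nonneg x) (k - 1)
    have := pow_nonneg (norm_nonneg y) (k - 1)
    rcases max_choice ‖x‖ ‖y‖ with h | h <;> rw [h] <;> linarith
  calc |‖x‖ - ‖y‖| * k * max ‖x‖ ‖y‖ ^ (k - 1)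
      ≤ ‖x - y‖ * k * (1 + ‖x‖ ^ (k - 1) + ‖y‖ ^ (k - 1)) := by
        gcongr
        exact abs_norm_sub_norm_le x y
    _ = _ := by ring

/-! ### Estimates under a sublinear expectation -/

namespace SublinearExpectationSpace

variable {Ω : Type*} (S : SublinearExpectationSpace Ω)

theorem sub_mem {X Y : Ω → ℝ} (hX : X ∈ S.H) (hY : Y ∈ S.H) : (fun ω => X ω - Y ω) ∈ S.H :=
  S.H.sub_mem hX hY

theorem add_mem {X Y : Ω → ℝ} (hX : X ∈ S.H) (hY : Y ∈ S.H) : (fun ω => X ω + Y ω) ∈ S.H :=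
  S.H.add_mem hX hY

theorem mul_mem (c : ℝ) {X : Ω → ℝ} (hX : X ∈ S.H) : (fun ω => c * X ω) ∈ S.H :=
  S.H.smul_mem c hX

theorem E_const_mul {X : Ω → ℝ} (hX : X ∈ S.H) {c : ℝ} (hc : 0 ≤ c) :
    S.E (fun ω => c * X ω) = c * S.E X := by
  rcases hc.eq_or_lt with rfl | h
  · simpa using S.map_const 0
  · exact S.pos_hom X hX c h

theorem E_add_mul_le {X : Ω → ℝ} (hX : X ∈ S.H) (a : ℝ) {c : ℝ} (hc : 0 ≤ c) :
    S.E (fun ω => a + c * X ω) ≤ a + c * S.E X := by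
  have := S.subadd _ (S.const_mem a) _ (S.mul_mem c hX)
  rwa [S.map_const, S.E_const_mul hX hc] at this

/-- From X ≤ Y + D, monotonicity and sub-additivity give E X ≤ E Y + E D. This replaces linearity
throughout. -/
theorem abs_E_sub_le {X Y D : Ω → ℝ} (hX : X ∈ S.H) (hY : Y ∈ S.H) (hD : D ∈ S.H)
    (h : ∀ ω, |X ω - Y ω| ≤ D ω) : |S.E X - S.E Y| ≤ S.E D := by
  have key : ∀ {X Y : Ω → ℝ}, X ∈ S.H → Y ∈ S.H → (∀ ω, X ω ≤ Y ω + D ω) →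
      S.E X ≤ S.E Y + S.E D := fun {X Y} hX hY h =>
    (S.mono _ (S.add_mem hY hD) _ hX h).trans (S.subadd _ hY _ hD)
  rw [abs_le]
  constructor
  · linarith [key hY hX fun ω => by linarith [(abs_le.1 (h ω)).1]]
  · linarith [key hX hY fun ω => by linarith [(abs_le.1 (h ω)).2]]

/-- All `ψ(δ)` with `ψ` in `C_{l,lip}(ℝ)` belong to the space of random variables. -/
def HasClLipImages (δ : Ω → ℝ) : Prop := ∀ ψ : ℝ → ℝ, IsClLip ψ → (fun ω => ψ (δ ω)) ∈ S.H

variable {S}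

theorem IsGNormal.hasClLipImages {δ : Ω → ℝ} {vl vu : ℝ} (h : S.IsGNormal δ vl vu) :
    S.HasClLipImages δ := fun ψ hψ => by
  simpa using (h ψ hψ).1 1 zero_le_one 0

namespace HasClLipImages

variable {δ : Ω → ℝ}

theorem abs_pow_mem (hδ : S.HasClLipImages δ) (k : ℕ) : (fun ω => |δ ω| ^ k) ∈ S.H := hδ _ (isClLip_norm_pow k)

theorem comp_affine_mem (hδ : S.HasClLipImages δ) {φ : ℝ → ℝ} (hφ : IsClLip φ) (x d : ℝ) :
    (fun ω => φ (x + d * δ ω)) ∈ S.H := hδ _ (hφ.comp_affine x d)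

theorem E_abs_pow_nonneg (hδ : S.HasClLipImages δ) (k : ℕ) : 0 ≤ S.E fun ω => |δ ω| ^ k := by
  have := S.mono _ (hδ.abs_pow_mem k) _ (S.const_mem 0) fun ω => by positivity
  rwa [S.map_const] at this

/-- Makes iterated expectations possible: the inner one is again an admissible initial value and
stays in H when a suitable random variable is inserted. The increment is controlled by the m-th
absolute moment. -/
theorem isClLip_E (hδ : S.HasClLipImages δ) {φ : ℝ → ℝ} (hφ : IsClLip φ) (d : ℝ) :
    IsClLip fun x => S.E fun ω => φ (x + d * δ ω) := by
  obtain ⟨C, m, hC, h⟩ := hφ.nonneg_const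
  have hM := hδ.E_abs_pow_nonneg m
  set M := S.E fun ω => |δ ω| ^ m with hM_def
  refine ⟨C * 2 ^ m * (1 + 2 * |d| ^ m * M), m, fun x y => ?_⟩
  set A := C * 2 ^ m * (1 + |x| ^ m + |y| ^ m) * |x - y| with hA
  set B := C * 2 ^ m * (2 * |d| ^ m) * |x - y| with hB
  have hb : ∀ x ω, |x + d * δ ω| ^ m ≤ 2 ^ m * (|x| ^ m + |d| ^ m * |δ ω| ^ m) := fun x ω => by
    rw [← mul_pow, ← abs_mul]
    exact (pow_le_pow_left₀ (abs_nonneg _) (abs_add_le _ _) m).trans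
      (add_pow_le_two_pow (abs_nonneg _) (abs_nonneg _) m)
  have h1 : ∀ ω, |φ (x + d * δ ω) - φ (y + d * δ ω)| ≤ A + B * |δ ω| ^ m := fun ω => by
    refine (h _ _).trans ?_
    rw [add_sub_add_right_eq_sub]
    simp only [Real.norm_eq_abs]
    have e : A + B * |δ ω| ^ m = C * (2 ^ m * 1 + 2 ^ m * (|x| ^ m + |d| ^ m * |δ ω| ^ m) +
        2 ^ m * (|y| ^ m + |d| ^ m * |δ ω| ^ m)) * |x - y| := by rw [hA, hB]; ring
    rw [e]
    gcongr
    · rw [mul_one]; exact one_le_pow₀ (by norm_num)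
    · exact hb x ω
    · exact hb y ω
  have h2 := S.abs_E_sub_le (hδ.comp_affine_mem hφ x d) (hδ.comp_affine_mem hφ y d)
    (S.add_mem (S.const_mem A) (S.mul_mem B (hδ.abs_pow_mem m))) h1
  refine (h2.trans (S.E_add_mul_le (hδ.abs_pow_mem m) A (by positivity))).trans ?_
  rw [← hM_def, hA, hB]
  simp only [Real.norm_eq_abs]
  have : 0 ≤ C * 2 ^ m * (2 * |d| ^ m * M) * (|x| ^ m + |y| ^ m) * |x - y| := by positivity
  linarith

theorem hasPolynomialGrowth_flow (hδ : S.HasClLipImages δ) {φ : ℝ → ℝ} (hφ : IsClLip φ) :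
    HasPolynomialGrowth (S.flow δ φ) := by
  intro T
  obtain ⟨C, m, hC, h⟩ := hφ.exists_bound
  have hM := hδ.E_abs_pow_nonneg m
  set M := S.E fun ω => |δ ω| ^ m with hM_def
  refine ⟨C * 2 ^ m * (1 + √T ^ m * M), m, fun t ht x => ?_⟩
  set A := C * 2 ^ m * (1 + |x| ^ m) with hA
  set B := C * 2 ^ m * √T ^ m with hB
  have h1 : ∀ ω, |φ (x + √t * δ ω) - 0| ≤ A + B * |δ ω| ^ m := fun ω => by
    rw [sub_zero]
    refine (h _).trans ?_
    have e : A + B * |δ ω| ^ m = C * (2 ^ m * 1 + 2 ^ m * (|x| ^ m + √T ^ m * |δ ω| ^ m)) := by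
      rw [hA, hB]; ring
    rw [e]
    gcongr
    · rw [mul_one]; exact one_le_pow₀ (by norm_num)
    · have h2 : ‖x + √t * δ ω‖ ≤ |x| + √T * |δ ω| := by
        refine (abs_add_le _ _).trans ?_
        rw [abs_mul, abs_of_nonneg (Real.sqrt_nonneg t)]
        gcongr
        exact ht.2
      rw [← mul_pow]
      exact (pow_le_pow_left₀ (norm_nonneg _) h2 m).trans
        (add_pow_le_two_pow (abs_nonneg _) (by positivity) m)
  have h2 := S.abs_E_sub_le (hδ.comp_affine_mem hφ x √t) (S.const_mem 0)
    (S.add_mem (S.const_mem A) (S.mul_mem B (hδ.abs_pow_mem m))) h1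
  rw [S.map_const, sub_zero] at h2
  refine (h2.trans (S.E_add_mul_le (hδ.abs_pow_mem m) A (by positivity))).trans ?_
  rw [← hM_def, hA, hB]
  have : 0 ≤ C * 2 ^ m * (√T ^ m * M) * |x| ^ m := by positivity
  linarith

end HasClLipImages

end SublinearExpectationSpace

/-! ### Independence for unbounded functions -/

/-- Truncation acts only where |a| > N, and there |a| ≤ a² / N. -/
theorem abs_sub_truncate_le {a B N : ℝ} (hN : 0 < N) (h : |a| ≤ B) :
    |a - max (-N) (min N a)| ≤ B ^ 2 / N := by
  have hB := (abs_nonneg a).trans h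
  have key : N < |a| → |a| - N ≤ B ^ 2 / N := fun h1 => by
    rw [le_div_iff₀ hN]
    nlinarith
  rcases le_total a N with h1 | h1
  · rcases le_total (-N) a with h2 | h2
    · rw [min_eq_right h1, max_eq_right h2, sub_self, abs_zero]
      positivity
    · rw [min_eq_right h1, max_eq_left h2]
      rcases h2.eq_or_lt with rfl | h3
      · rw [sub_self, abs_zero]; positivity
      · have h4 : |a| = -a := abs_of_neg (by linarith)
        rw [abs_of_nonpos (by linarith)]
        linarith [key (by linarith)]
  · rw [min_eq_left h1, max_eq_right (by linarith), abs_of_nonneg (by linarith)]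
    rcases h1.eq_or_lt with rfl | h3
    · rw [sub_self]; positivity
    · have h4 : |a| = a := abs_of_pos (by linarith)
      linarith [key (by linarith)]

namespace SublinearExpectationSpace

variable {Ω : Type*} {S : SublinearExpectationSpace Ω}

theorem truncate_mem {X : Ω → ℝ} (hX : X ∈ S.H) (N : ℝ) :
    (fun ω => max (-N) (min N (X ω))) ∈ S.H := by
  refine S.comp_mem 1 (fun x => max (-N) (min N (x 0))) (by fun_prop) ⟨|N|, fun x => ?_⟩
    (fun _ => X) fun _ => hX
  rw [abs_le]
  exact ⟨(neg_le_neg (le_abs_self N)).trans (le_max_left _ _),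
    max_le (neg_le_abs N) ((min_le_left _ _).trans (le_abs_self N))⟩

/-- Independence extends from bounded Borel functions to functions in `C_{l,lip}`. -/
theorem IsIndependentOf.E_eq {X Y : Ω → ℝ} (hind : S.IsIndependentOf Y X)
    (hX : S.HasClLipImages X) (hY : S.HasClLipImages Y) {φ : ℝ → ℝ} (hφ : IsClLip φ)
    (x c d : ℝ) (hmem : (fun ω => φ (x + c * X ω + d * Y ω)) ∈ S.H) :
    S.E (fun ω => φ (x + c * X ω + d * Y ω)) =
      S.E fun ω => S.E fun ω' => φ (x + c * X ω + d * Y ω') := by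
  obtain ⟨C, m, hC, hb⟩ := hφ.exists_bound
  set D := C * (1 + 2 ^ m * (2 ^ m * (|x| ^ m + |c| ^ m + |d| ^ m))) with hD
  have hD0 : 0 ≤ D := by positivity
  have hbound : ∀ p q : ℝ, |φ (x + c * p + d * q)| ≤ D * (1 + |p| ^ m + |q| ^ m) := fun p q => by
    refine (hb _).trans ?_
    rw [hD, mul_assoc]
    refine mul_le_mul_of_nonneg_left ?_ hC
    have h1 : ‖x + c * p + d * q‖ ≤ (|x| + |c| * |p|) + |d| * |q| := by
      rw [← abs_mul, ← abs_mul]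
      exact (abs_add_le _ _).trans (add_le_add_left (abs_add_le _ _) _)
    have h2 := (pow_le_pow_left₀ (norm_nonneg _) h1 m).trans
      (add_pow_le_two_pow (by positivity) (by positivity) m)
    have h3 := add_pow_le_two_pow (abs_nonneg x) (show 0 ≤ |c| * |p| by positivity) m
    rw [mul_pow] at h2 h3
    have h4 : (1 : ℝ) ≤ 2 ^ m := one_le_pow₀ (by norm_num)
    have h5 : |d| ^ m * |q| ^ m ≤ 2 ^ m * (|d| ^ m * |q| ^ m) :=
      le_mul_of_one_le_left (by positivity) h4
    have h6 : (|x| + |c| * |p|) ^ m + |d| ^ m * |q| ^ m ≤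
        2 ^ m * (|x| ^ m + |c| ^ m * |p| ^ m + |d| ^ m * |q| ^ m) := by linarith
    have h7 : |x| ^ m + |c| ^ m * |p| ^ m + |d| ^ m * |q| ^ m ≤
        (|x| ^ m + |c| ^ m + |d| ^ m) * (1 + |p| ^ m + |q| ^ m) := by
      have : 0 ≤ |x| ^ m * (|p| ^ m + |q| ^ m) + |c| ^ m * (1 + |q| ^ m) +
        |d| ^ m * (1 + |p| ^ m) := by positivity
      linarith
    have h8 := mul_le_mul_of_nonneg_left (h6.trans
      (mul_le_mul_of_nonneg_left h7 (by positivity))) (show (0 : ℝ) ≤ 2 ^ m by positivity)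
    have h9 : 0 ≤ |p| ^ m + |q| ^ m := by positivity
    linarith
  -- The factor 3 comes from (1 + a + b)² ≤ 3 (1 + a² + b²).
  set K := 3 * D ^ 2 with hK
  have herr : ∀ N > 0, ∀ p q : ℝ, |φ (x + c * p + d * q) -
      max (-N) (min N (φ (x + c * p + d * q)))| ≤
        K / N * (1 + |p| ^ (2 * m) + |q| ^ (2 * m)) := fun N hN p q => by
    refine (abs_sub_truncate_le hN (hbound p q)).trans ?_
    rw [div_mul_eq_mul_div]
    refine div_le_div_of_nonneg_right ?_ hN.le
    rw [hK, mul_pow, mul_comm 3, mul_assoc]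
    refine mul_le_mul_of_nonneg_left ?_ (sq_nonneg D)
    rw [pow_mul', pow_mul']
    nlinarith [sq_nonneg (|p| ^ m - |q| ^ m), sq_nonneg (|p| ^ m - 1), sq_nonneg (|q| ^ m - 1)]
  have hMX := hX.E_abs_pow_nonneg (2 * m)
  have hMY := hY.E_abs_pow_nonneg (2 * m)
  set MX := S.E fun ω => |X ω| ^ (2 * m) with hMX_def
  set MY := S.E fun ω => |Y ω| ^ (2 * m) with hMY_def
  have hYmem : ∀ p, (fun ω => φ (x + c * p + d * Y ω)) ∈ S.H := fun p =>
    hY.comp_affine_mem hφ (x + c * p) d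
  have hg : (fun ω => S.E fun ω' => φ (x + c * X ω + d * Y ω')) ∈ S.H :=
    hX _ ((hY.isClLip_E hφ d).comp_affine x c)
  -- The truncated sides agree by independence, and truncation costs O(1 / N) on each side with a
  -- constant made of 2m-th moments. This rate makes continuity of E along monotone sequences
  -- unnecessary.
  have hclose : ∀ N > 0, |S.E (fun ω => φ (x + c * X ω + d * Y ω)) -
      S.E (fun ω => S.E fun ω' => φ (x + c * X ω + d * Y ω'))| ≤
        2 * K * (1 + MX + MY) / N := fun N hN => by
    have hKN : 0 ≤ K / N := by positivity
    obtain ⟨hgN, hEN⟩ := hind (fun p => max (-N) (min N (φ (x + c * p.1 + d * p.2))))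
      (by have := hφ.continuous.measurable; fun_prop) ⟨|N|, fun p => by
        rw [abs_le]
        exact ⟨(neg_le_neg (le_abs_self N)).trans (le_max_left _ _),
          max_le (neg_le_abs N) ((min_le_left _ _).trans (le_abs_self N))⟩⟩
    simp only at hgN hEN
    have hpX := hX.abs_pow_mem (2 * m)
    have hpY := hY.abs_pow_mem (2 * m)
    have h1 := S.abs_E_sub_le hmem (truncate_mem hmem N)
      (S.mul_mem (K / N) (S.add_mem (S.add_mem (S.const_mem 1) hpX) hpY))
      fun ω => herr N hN (X ω) (Y ω)
    rw [S.E_const_mul (S.add_mem (S.add_mem (S.const_mem 1) hpX) hpY) hKN] at h1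
    have h2 : S.E (fun ω => 1 + |X ω| ^ (2 * m) + |Y ω| ^ (2 * m)) ≤ 1 + MX + MY := by
      have a1 := S.subadd _ (S.add_mem (S.const_mem 1) hpX) _ hpY
      have a2 := S.subadd _ (S.const_mem 1) _ hpX
      rw [S.map_const] at a2
      linarith
    have h3 : ∀ p, |S.E (fun ω' => φ (x + c * p + d * Y ω')) -
        S.E (fun ω' => max (-N) (min N (φ (x + c * p + d * Y ω'))))| ≤
          K / N * (1 + MY) + K / N * |p| ^ (2 * m) := fun p => by
      have b1 := S.abs_E_sub_le (hYmem p) (truncate_mem (hYmem p) N)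
        (D := fun ω => K / N * (1 + |p| ^ (2 * m)) + K / N * |Y ω| ^ (2 * m))
        (S.add_mem (S.const_mem _) (S.mul_mem (K / N) hpY))
        fun ω => (herr N hN p (Y ω)).trans_eq (by ring)
      refine b1.trans ((S.E_add_mul_le hpY _ hKN).trans_eq ?_)
      ring
    have h4 := (S.abs_E_sub_le hg hgN
      (S.add_mem (S.const_mem _) (S.mul_mem (K / N) hpX)) fun ω => h3 (X ω)).trans
      (S.E_add_mul_le hpX _ hKN)
    rw [hEN] at h1
    have h5 := h1.trans (mul_le_mul_of_nonneg_left h2 hKN)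
    rw [abs_sub_comm] at h4
    refine (abs_sub_le _ _ _).trans ((add_le_add h5 h4).trans_eq ?_)
    rw [← hMX_def]
    ring
  have hlim : Tendsto (fun N : ℝ => 2 * K * (1 + MX + MY) / N) atTop (𝓝 0) :=
    tendsto_const_nhds.div_atTop tendsto_id
  have := ge_of_tendsto hlim ((eventually_gt_atTop 0).mono hclose)
  exact sub_eq_zero.1 (abs_eq_zero.1 (le_antisymm this (abs_nonneg _)))

end SublinearExpectationSpace

/-! ### Uniqueness and transformations of viscosity solutions -/

theorem HasPolynomialGrowth.expGrowth {u : ℝ → ℝ → ℝ} (h : HasPolynomialGrowth u) :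
    ExpGrowth u := by
  intro T
  obtain ⟨C, m, h⟩ := h T
  refine ⟨|C| * (1 + m.factorial), fun t ht x => (h t ht x).trans ?_⟩
  have h1 := Real.pow_div_factorial_le_exp |x| (abs_nonneg x) m
  rw [div_le_iff₀ (by positivity)] at h1
  have h2 : 1 ≤ Real.exp |x| := Real.one_le_exp (abs_nonneg x)
  calc C * (1 + |x| ^ m) ≤ |C| * (1 + |x| ^ m) := by
        gcongr
        exact le_abs_self C
    _ ≤ |C| * (Real.exp |x| + Real.exp |x| * m.factorial) := by gcongr
    _ = _ := by ring

theorem HasPolynomialGrowth.comp_affine {u : ℝ → ℝ → ℝ} (h : HasPolynomialGrowth u) {k t₀ r : ℝ}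
    (hk : 0 ≤ k) (ht₀ : 0 ≤ t₀) (hr : |r| = 1) :
    HasPolynomialGrowth fun t x => u (t₀ + k * t) (r * x) := by
  intro T
  obtain ⟨C, m, h⟩ := h (t₀ + k * T)
  refine ⟨C, m, fun t ht x => ?_⟩
  have := h (t₀ + k * t) ⟨add_nonneg ht₀ (mul_nonneg hk ht.1), by
    have := mul_le_mul_of_nonneg_left ht.2 hk
    linarith⟩ (r * x)
  rwa [abs_mul, hr, one_mul] at this

namespace IsViscositySolution

variable {vl vu : ℝ} {φ : ℝ → ℝ} {u v : ℝ → ℝ → ℝ}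

theorem isSubSol (h : IsViscositySolution vl vu φ u) : IsSubSol (gFun vl vu) u := h.sub

theorem isSubSol_neg (h : IsViscositySolution vl vu φ u) :
    IsSubSol (fun X => -gFun vl vu (-X)) fun t x => -u t x := isSubSol_neg_iff.2 h.super

theorem unique (hvl : 0 ≤ vl) (hv : vl ≤ vu) (hu : IsViscositySolution vl vu φ u)
    (hug : HasPolynomialGrowth u) (hw : IsViscositySolution vl vu φ v)
    (hwg : HasPolynomialGrowth v) {t : ℝ} (ht : 0 ≤ t) (x : ℝ) : u t x = v t x :=
  le_antisymm
    (hu.isSubSol.le_of_isSubSol_neg hvl hv hu.cont hug.expGrowth hw.isSubSol_neg hw.cont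
      hwg.expGrowth (fun x => (hu.init x).trans_le (hw.init x).ge) ht x)
    (hw.isSubSol.le_of_isSubSol_neg hvl hv hw.cont hwg.expGrowth hu.isSubSol_neg hu.cont
      hug.expGrowth (fun x => (hw.init x).trans_le (hu.init x).ge) ht x)

theorem congr (h : IsViscositySolution vl vu φ u) (huv : ∀ t ≥ 0, ∀ x, u t x = v t x) :
    IsViscositySolution vl vu φ v where
  cont := h.cont.congr fun p hp => (huv p.1 hp.1 p.2).symm
  init x := (huv 0 le_rfl x).symm.trans (h.init x)
  sub := h.isSubSol.congr fun t ht => huv t ht.le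
  super := isSubSol_neg_iff.1 (h.isSubSol_neg.congr fun t ht x => by rw [huv t ht.le])

/-- Speeding up time by k multiplies G, hence both coefficients, by k; a reflection leaves the
second derivative unchanged. -/
theorem comp_affine (h : IsViscositySolution vl vu φ u) {k t₀ r : ℝ} (hk : 0 < k) (ht₀ : 0 ≤ t₀)
    (hr : r * r = 1) : IsViscositySolution (k * vl) (k * vu) (fun x => u t₀ (r * x))
      fun t x => u (t₀ + k * t) (r * x) := by
  have hG : ∀ X, k * gFun vl vu X = gFun (k * vl) (k * vu) X := fun X => by
    simp only [gFun]; ring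
  refine ⟨?_, fun x => by simp, ?_, isSubSol_neg_iff (F := gFun (k * vl) (k * vu))
    (u := fun t x => u (t₀ + k * t) (r * x)) |>.1 ?_⟩
  · exact h.cont.comp (t := Ici 0 ×ˢ univ) (f := fun p : ℝ × ℝ => (t₀ + k * p.1, r * p.2))
      (Continuous.continuousOn (by fun_prop))
      fun p hp => ⟨add_nonneg ht₀ (mul_nonneg hk.le hp.1), mem_univ _⟩
  · exact (h.isSubSol.comp_affine hk ht₀ hr).mono fun X => (hG X).le
  · exact (h.isSubSol_neg.comp_affine hk ht₀ hr).mono fun X => by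
      rw [mul_neg, hG]

/-- Although φ is merely continuous, φ x - ψ s x has an extremum in s at a touching point, so the
time derivative of ψ vanishes there. -/
theorem of_coeff_zero (hφ : Continuous φ) : IsViscositySolution 0 0 φ fun _ => φ := by
  have hG : ∀ X, gFun 0 0 X = 0 := fun X => by simp [gFun]
  have key : ∀ ψ : ℝ → ℝ → ℝ, ∀ t x : ℝ,
      IsLocalExtr (fun p : ℝ × ℝ => φ p.2 - ψ p.1 p.2) (t, x) →
        deriv (fun s => ψ s x) t = 0 := fun ψ t x h => by
    have h1 : IsLocalExtr (fun s => φ x - ψ s x) t := by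
      have hc : ContinuousAt (fun s : ℝ => (s, x)) t := by fun_prop
      exact h.elim (fun h => .inl (hc.eventually h)) fun h => .inr (hc.eventually h)
    have h2 := h1.deriv_eq_zero
    rwa [deriv_const_sub, neg_eq_zero] at h2
  refine ⟨(hφ.comp continuous_snd).continuousOn, fun _ => rfl, fun ψ _ t _ x h => ?_,
    fun ψ _ t _ x h => ?_⟩
  · rw [key ψ t x (.inr h), hG, sub_zero]
  · rw [key ψ t x (.inl h), hG, sub_zero]

end IsViscositySolution

/-! ### G-normal variables -/

namespace SublinearExpectationSpace

variable {Ω : Type*} {S : SublinearExpectationSpace Ω} {vl vu : ℝ}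

theorem IsGNormal.hasPolynomialGrowth {δ : Ω → ℝ} (h : S.IsGNormal δ vl vu) {φ : ℝ → ℝ}
    (hφ : IsClLip φ) : HasPolynomialGrowth (S.flow δ φ) :=
  h.hasClLipImages.hasPolynomialGrowth_flow hφ

theorem IsGNormal.flow_eq {X Y : Ω → ℝ} (hX : S.IsGNormal X vl vu) (hY : S.IsGNormal Y vl vu)
    (hvl : 0 ≤ vl) (hv : vl ≤ vu) {φ : ℝ → ℝ} (hφ : IsClLip φ) {t : ℝ} (ht : 0 ≤ t) (x : ℝ) :
    S.flow X φ t x = S.flow Y φ t x :=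
  (hX φ hφ).2.unique hvl hv (hX.hasPolynomialGrowth hφ) (hY φ hφ).2 (hY.hasPolynomialGrowth hφ) ht x

/-- A `G`-normal variable is symmetric. -/
theorem IsGNormal.E_affine {δ : Ω → ℝ} (h : S.IsGNormal δ vl vu) (hvl : 0 ≤ vl) (hv : vl ≤ vu)
    {φ : ℝ → ℝ} (hφ : IsClLip φ) (d x : ℝ) :
    S.E (fun ω => φ (x + d * δ ω)) = S.flow δ φ (d ^ 2) x := by
  rcases le_total 0 d with hd | hd
  · simp only [flow, Real.sqrt_sq hd]
  -- For d ≤ 0, take the flow of φ(-·) and reflect it in x: it solves the same equation with initial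
  -- value φ, so by uniqueness it is the flow of φ.
  · have hφ' : IsClLip fun y => φ (-y) := by simpa using hφ.comp_affine 0 (-1)
    have hs := (h _ hφ').2.comp_affine one_pos le_rfl (r := -1) (by norm_num)
    have hg := (h.hasPolynomialGrowth hφ').comp_affine (k := 1) (t₀ := 0) (r := -1)
      zero_le_one le_rfl (by norm_num)
    have hi : (fun x => S.flow δ (fun y => φ (-y)) 0 (-1 * x)) = φ := by
      funext x
      rw [(h _ hφ').2.init]
      simp
    rw [hi, one_mul, one_mul] at hs
    rw [← hs.unique hvl hv hg (h φ hφ).2 (h.hasPolynomialGrowth hφ) (sq_nonneg d) x]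
    simp only [flow, one_mul, zero_add, Real.sqrt_sq_eq_abs, abs_of_nonpos hd]
    congr 1
    funext ω
    congr 1
    ring

/-- The semigroup property of the flow of a `G`-normal variable. -/
theorem IsGNormal.flow_flow {δ : Ω → ℝ} (h : S.IsGNormal δ vl vu) (hvl : 0 ≤ vl) (hv : vl ≤ vu)
    {φ : ℝ → ℝ} (hφ : IsClLip φ) {s t : ℝ} (hs : 0 ≤ s) (ht : 0 ≤ t) (x : ℝ) :
    S.flow δ (S.flow δ φ s) t x = S.flow δ φ (s + t) x := by
  have hψ : IsClLip (S.flow δ φ s) := h.hasClLipImages.isClLip_E hφ √s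
  -- The flow restarted at time s solves the equation with initial value its slice at s; uniqueness
  -- does the rest.
  have hs' := (h _ hφ).2.comp_affine one_pos hs (r := 1) (by norm_num)
  have hg := (h.hasPolynomialGrowth hφ).comp_affine (k := 1) (r := 1) zero_le_one hs (by norm_num)
  simp only [one_mul] at hs' hg
  exact (h _ hψ).2.unique hvl hv (h.hasPolynomialGrowth hψ) hs' hg ht x

/-! ### Linear combinations of the real and imaginary parts -/

section Pair

variable {Z : Ω → ℂ} (hZ : ∀ ψ : ℂ → ℝ, IsClLip ψ → (fun ω => ψ (Z ω)) ∈ S.H)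
  (hRe : S.IsGNormal (fun ω => (Z ω).re) vl vu) (hIm : S.IsGNormal (fun ω => (Z ω).im) vl vu)
  (hind : S.IsIndependentOf (fun ω => (Z ω).im) (fun ω => (Z ω).re))

include hZ in
theorem linear_comb_mem {φ : ℝ → ℝ} (hφ : IsClLip φ) (x c d : ℝ) :
    (fun ω => φ (x + c * (Z ω).re + d * (Z ω).im)) ∈ S.H := by
  refine hZ (fun z => φ (x + c * z.re + d * z.im)) ?_
  refine hφ.comp_lipschitz (f := fun z : ℂ => x + c * z.re + d * z.im) (L := |c| + |d|)
    (fun z w => ?_) (by positivity)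
  have e : x + c * z.re + d * z.im - (x + c * w.re + d * w.im) =
      c * (z - w).re + d * (z - w).im := by
    rw [Complex.sub_re, Complex.sub_im]; ring
  rw [e, add_mul]
  refine (abs_add_le _ _).trans ?_
  rw [abs_mul, abs_mul]
  exact add_le_add (mul_le_mul_of_nonneg_left (Complex.abs_re_le_norm _) (abs_nonneg c))
    (mul_le_mul_of_nonneg_left (Complex.abs_im_le_norm _) (abs_nonneg d))

include hZ hRe hIm hind in
/-- The flow of a linear combination of independent identically distributed `G`-normal variables. -/
theorem flow_linear_comb (hvl : 0 ≤ vl) (hv : vl ≤ vu) {φ : ℝ → ℝ} (hφ : IsClLip φ)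
    (c d : ℝ) {t : ℝ} (ht : 0 ≤ t) (x : ℝ) :
    S.flow (fun ω => c * (Z ω).re + d * (Z ω).im) φ t x =
      S.flow (fun ω => (Z ω).re) φ ((c ^ 2 + d ^ 2) * t) x := by
  have hsq : ∀ a : ℝ, (√t * a) ^ 2 = t * a ^ 2 := fun a => by rw [mul_pow, Real.sq_sqrt ht]
  have hta : ∀ a : ℝ, 0 ≤ t * a ^ 2 := fun a => by positivity
  have hψ : IsClLip (S.flow (fun ω => (Z ω).re) φ (t * d ^ 2)) :=
    hRe.hasClLipImages.isClLip_E hφ _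
  calc S.flow (fun ω => c * (Z ω).re + d * (Z ω).im) φ t x
      = S.E fun ω => φ (x + √t * c * (Z ω).re + √t * d * (Z ω).im) := by
        rw [flow]
        congr 1
        funext ω
        congr 1
        ring
    _ = S.E fun ω => S.E fun ω' => φ (x + √t * c * (Z ω).re + √t * d * (Z ω').im) :=
        hind.E_eq hRe.hasClLipImages hIm.hasClLipImages hφ x _ _ (linear_comb_mem hZ hφ x _ _)
    _ = S.E fun ω => S.flow (fun ω => (Z ω).re) φ (t * d ^ 2) (x + √t * c * (Z ω).re) := by
        -- For fixed ω the inner expectation is a flow of Im Z for time t d², which may be replaced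
        -- by that of Re Z.
        congr 1
        funext ω
        rw [hIm.E_affine hvl hv hφ, hsq, hRe.flow_eq hIm hvl hv hφ (hta d)]
    _ = S.flow (fun ω => (Z ω).re) φ ((c ^ 2 + d ^ 2) * t) x := by
        rw [hRe.E_affine hvl hv hψ, hsq, hRe.flow_flow hvl hv hφ (hta d) (hta c)]
        congr 1
        ring

include hZ hRe hIm hind in
theorem isGNormal_linear_comb (hvl : 0 ≤ vl) (hv : vl ≤ vu) (c d : ℝ) :
    S.IsGNormal (fun ω => c * (Z ω).re + d * (Z ω).im)
      ((c ^ 2 + d ^ 2) * vl) ((c ^ 2 + d ^ 2) * vu) := by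
  intro φ hφ
  refine ⟨fun t _ x => ?_, ?_⟩
  · have := linear_comb_mem hZ hφ x (√t * c) (√t * d)
    simpa only [mul_add, ← mul_assoc, ← add_assoc] using this
  · have hflow := fun t (ht : t ≥ 0) x =>
      (flow_linear_comb hZ hRe hIm hind hvl hv hφ c d ht x).symm
    have hinit := (hRe φ hφ).2.init
    -- Time can be rescaled only by a positive factor; for c = d = 0 the flow is constant in time
    -- and both coefficients vanish.
    rcases (show 0 ≤ c ^ 2 + d ^ 2 by positivity).eq_or_lt with hk | hk
    · rw [← hk, zero_mul, zero_mul]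
      refine (IsViscositySolution.of_coeff_zero hφ.continuous).congr fun t ht x => ?_
      rw [← hflow t ht x, ← hk, zero_mul, hinit]
    · have h1 := (hRe φ hφ).2.comp_affine hk le_rfl (r := 1) (by norm_num)
      simp only [one_mul, zero_add, hinit] at h1
      exact h1.congr hflow

end Pair

end SublinearExpectationSpace

theorem mainTheorem7 {Ω : Type*} (S : SublinearExpectationSpace Ω) (Z : Ω → ℂ)
    (hZ : ∀ ψ : ℂ → ℝ, IsClLip ψ → (fun ω => ψ (Z ω)) ∈ S.H)
    (σl σu : ℝ) (hσl : 0 ≤ σl) (hσ : σl ≤ σu)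
    (hRe : S.IsGNormal (fun ω => (Z ω).re) (σl ^ 2) (σu ^ 2))
    (hIm : S.IsGNormal (fun ω => (Z ω).im) (σl ^ 2) (σu ^ 2))
    (hind : S.IsIndependentOf (fun ω => (Z ω).im) (fun ω => (Z ω).re))
    (h : ℂ) :
    S.IsGNormal (fun ω => (h * Z ω).re) (‖h‖ ^ 2 * σl ^ 2) (‖h‖ ^ 2 * σu ^ 2) ∧
    S.IsGNormal (fun ω => (h * Z ω).im) (‖h‖ ^ 2 * σl ^ 2) (‖h‖ ^ 2 * σu ^ 2) ∧
    ∀ φ : ℝ → ℝ, IsClLip φ → ∀ v : ℝ → ℝ → ℝ,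
      IsViscositySolution (‖h‖ ^ 2 * σl ^ 2) (‖h‖ ^ 2 * σu ^ 2) φ v → HasPolynomialGrowth v →
        ∀ t ≥ 0, ∀ x, v t x = S.flow (fun ω => (h * Z ω).re) φ t x ∧
          v t x = S.flow (fun ω => (h * Z ω).im) φ t x := by
  have hv : σl ^ 2 ≤ σu ^ 2 := pow_le_pow_left₀ hσl hσ 2
  have hk : ‖h‖ ^ 2 = h.re ^ 2 + h.im ^ 2 := by
    rw [Complex.sq_norm, Complex.normSq_apply, sq, sq]
  have h1 : S.IsGNormal (fun ω => (h * Z ω).re) (‖h‖ ^ 2 * σl ^ 2) (‖h‖ ^ 2 * σu ^ 2) := by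
    have := S.isGNormal_linear_comb hZ hRe hIm hind (sq_nonneg σl) hv h.re (-h.im)
    rw [neg_sq, ← hk] at this
    simpa only [Complex.mul_re, neg_mul, ← sub_eq_add_neg] using this
  have h2 : S.IsGNormal (fun ω => (h * Z ω).im) (‖h‖ ^ 2 * σl ^ 2) (‖h‖ ^ 2 * σu ^ 2) := by
    have := S.isGNormal_linear_comb hZ hRe hIm hind (sq_nonneg σl) hv h.im h.re
    rw [add_comm, ← hk] at this
    simpa only [Complex.mul_im, add_comm] using this
  have hl : 0 ≤ ‖h‖ ^ 2 * σl ^ 2 := by positivity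
  have hlu : ‖h‖ ^ 2 * σl ^ 2 ≤ ‖h‖ ^ 2 * σu ^ 2 := mul_le_mul_of_nonneg_left hv (sq_nonneg _)
  refine ⟨h1, h2, fun φ hφ v hvs hvg t ht x => ⟨?_, ?_⟩⟩
  · exact hvs.unique hl hlu hvg (h1 φ hφ).2 (h1.hasPolynomialGrowth hφ) ht x
  · exact hvs.unique hl hlu hvg (h2 φ hφ).2 (h2.hasPolynomialGrowth hφ) ht x
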